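/- All graphs are finite, simple and undirected. A vertex of degree $1$ is a leaf, and in a tree a vertex of degree at least $3$ is a branch. The minimum leaf number $\mathrm{ml}(G)$ of a graph $G$ is $1$ if $G$ has a hamiltonian cycle, $\infty$ if $G$ is disconnected, and otherwise the minimum number of leaves of a spanning tree of $G$ ($K_1$ and $K_2$ are not hamiltonian). An ml-subgraph of $G$ is a spanning tree or hamiltonian cycle $S$ of $G$ with $\mathrm{ml}(S)=\mathrm{ml}(G)$; let $\mathcal S_{\mathrm{ml}}(G)$ be the set of all of them. For ml-subgraphs $S$ of $G$ and $S_u$ of $G-u$ put $$\tau(S,S_u)=|\{z\in V(G)\setminus\{u\}:\deg_S(z)\neq\deg_{S_u}(z)\}| .$$ The fault cost of $G$ is $$\varphi(G)=\min_{S\in\mathcal S_{\mathrm{ml}}(G)}\ \max_{u\in V(G)}\ \min_{S_u\in\mathcal S_{\mathrm{ml}}(G-u)}\tau(S,S_u).$$ A graph $H$ is a Type 1 graph with designated vertices $v,w$ if there are vertices $x,y$ such that $v,w,x,y$ are pairwise distinct and (i) $H$ has no hamiltonian $vw$-path; (ii) there are a $vx$-path $P$ and a $wy$-path $Q$ in $H$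 such that $V(P),V(Q)$ partition $V(H)$; (iii) $H$ has a hamiltonian path from $v$ to a vertex of $\{x,y\}$ and a hamiltonian path from $w$ to a vertex of $\{x,y\}$; (iv) each of $H-v$ and $H-w$ has a hamiltonian path with one endpoint in $\{v,w\}$ and the other in $\{x,y\}$; (v) $H-u$ has a hamiltonian $vw$-path for every $u\in V(H)\setminus\{v,w\}$; (vi) $H$ has a spanning tree with exactly three leaves in which $v$ and $w$ are leaves and the remaining leaf and the branch lie in $\{x,y\}$. A graph $H$ is a Type 2 graph with designated vertices $v,w$ if $v\ne w$, $H$ has a hamiltonian $vw$-path, and for every $u\in V(H)\setminus\{v,w\}$ the graph $H-u$ has a hamiltonian $vw$-path or a spanning tree with exactly three leaves in which $v$ and $w$ are leaves. **Theorem.** Let $k\ge 3$, let $H_0$ be a Type 1 graph of order $n_0$ with designated vertices $v_0,w_0$, and for $1\le i\le k$ let $H_i$ be a Type 2 graph of order $n_i$ with designated vertices $v_i,w_i$. Let $G$ be obtained from the disjoint union of $H_0,\dots,H_k$ by adding the edges $w_iv_{i+1}$ for $0\le i\le k-1$ and the edge $w_kv_0$. Then $G$ is a $2$-connected graph of order $\sum_{i=0}^k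 n_i$ and $\varphi(G)=3$. The same holds for $k=2$ if, in addition, for each $i\in\{1,2\}$ there is no vertex $y$ of $H_i$ such that $H_i$ has both a hamiltonian $v_iy$-path and a hamiltonian $w_iy$-path. -/

import Mathlib

namespace FaultCost

/-- The degree of a vertex, as an extended natural number. -/
noncomputable def deg {V : Type*} (G : SimpleGraph V) (u : V) : ℕ∞ :=
  (G.neighborSet u).encard

/-- The set of leaves of `G`: the vertices of degree 1. -/
def leaves {V : Type*} (G : SimpleGraph V) : Set V :=
  {u | deg G u = 1}

/-- The number of leaves of `G`. -/
noncomputable def leafNumber {V : Type*} (G : SimpleGraph V) : ℕ∞ :=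
  (leaves G).encard

/-- The vertex-deleted subgraph `G - v`. -/
abbrev del {V : Type*} (G : SimpleGraph V) (v : V) : SimpleGraph ({v}ᶜ : Set V) :=
  G.induce ({v}ᶜ : Set V)

/-- `G` is 2-connected: it has more than two vertices, is connected and has no cut vertex. -/
def IsTwoConnected {V : Type*} (G : SimpleGraph V) : Prop :=
  2 < (Set.univ : Set V).encard ∧ G.Connected ∧ ∀ v : V, (del G v).Connected

open Classical in
/-- There is a hamiltonian `ab`-path in `G`. -/
def HasHamPath {V : Type*} (G : SimpleGraph V) (a b : V) : Prop :=
  ∃ p : G.Walk a b, p.IsHamiltonian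

/-- `T` is a spanning tree of `G`. -/
def IsSpanningTree {V : Type*} (G T : SimpleGraph V) : Prop :=
  T ≤ G ∧ T.IsTree

open Classical in
/-- `C` is (the spanning subgraph formed by) a hamiltonian cycle of `G`. -/
def IsHamCycle {V : Type*} (G C : SimpleGraph V) : Prop :=
  ∃ (a : V) (p : G.Walk a a), p.IsHamiltonianCycle ∧ C.edgeSet = {e | e ∈ p.edges}

/-- `G` has a hamiltonian cycle. The graphs `K₁` and `K₂` are not hamiltonian. -/
def IsHam {V : Type*} (G : SimpleGraph V) : Prop :=
  ∃ C : SimpleGraph V, IsHamCycle G C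

open Classical in
/-- The minimum leaf number: 1 for hamiltonian graphs, otherwise the minimum number of leaves of a
spanning tree (`⊤` if `G` is disconnected, as there is no spanning tree then). -/
noncomputable def ml {V : Type*} (G : SimpleGraph V) : ℕ∞ :=
  if IsHam G then 1 else ⨅ T ∈ {T : SimpleGraph V | IsSpanningTree G T}, leafNumber T

/-- The set of ml-subgraphs of `G`: the spanning trees and hamiltonian cycles `S` of `G` with
`ml S = ml G`. -/
def mlSubgraphs {V : Type*} (G : SimpleGraph V) : Set (SimpleGraph V) :=
  {S | (IsSpanningTree G S ∨ IsHamCycle G S) ∧ ml S = ml G}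

/-- The transition cost `τ(S, S_v)`: the number of vertices other than `v` whose degrees in `S` and
in `S_v` differ. -/
noncomputable def transitionCost {V : Type*} {v : V} (S : SimpleGraph V)
    (Sv : SimpleGraph ({v}ᶜ : Set V)) : ℕ∞ :=
  {u : ({v}ᶜ : Set V) | deg S (u : V) ≠ deg Sv u}.encard

/-- `φ_S(G)`: the worst case over `v` of the least transition cost from `S` to an ml-subgraph of
`G - v`. -/
noncomputable def faultCostOf {V : Type*} (G S : SimpleGraph V) : ℕ∞ :=
  ⨆ v : V, ⨅ Sv ∈ mlSubgraphs (del G v), transitionCost S Sv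

/-- The fault cost `φ(G)`. -/
noncomputable def faultCost {V : Type*} (G : SimpleGraph V) : ℕ∞ :=
  ⨅ S ∈ mlSubgraphs G, faultCostOf G S

/-- `T` is a 3-leaf spanning tree of `G`. -/
def IsThreeLeafSpanningTree {V : Type*} (G T : SimpleGraph V) : Prop :=
  IsSpanningTree G T ∧ leafNumber T = 3

/-- `H` is a Type 1 graph with designated vertices `v, w, x, y`. -/
structure IsType1With {V : Type*} (H : SimpleGraph V) (v w x y : V) : Prop where
  pairwise_ne : [v, w, x, y].Nodup
  no_ham : ¬ HasHamPath H v w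
  two_paths : ∃ (P : H.Walk v x) (Q : H.Walk w y), P.IsPath ∧ Q.IsPath ∧
    ∀ u : V, Xor (u ∈ P.support) (u ∈ Q.support)
  ham_v : ∃ z ∈ ({x, y} : Set V), HasHamPath H v z
  ham_w : ∃ z ∈ ({x, y} : Set V), HasHamPath H w z
  ham_del_v : ∃ a b : ({v}ᶜ : Set V), (a : V) ∈ ({v, w} : Set V) ∧ (b : V) ∈ ({x, y} : Set V) ∧
    HasHamPath (del H v) a b
  ham_del_w : ∃ a b : ({w}ᶜ : Set V), (a : V) ∈ ({v, w} : Set V) ∧ (b : V) ∈ ({x, y} : Set V) ∧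
    HasHamPath (del H w) a b
  ham_del : ∀ (u : V) (hv : v ≠ u) (hw : w ≠ u), HasHamPath (del H u) ⟨v, hv⟩ ⟨w, hw⟩
  tree : ∃ T : SimpleGraph V, IsThreeLeafSpanningTree H T ∧ v ∈ leaves T ∧ w ∈ leaves T ∧
    (∀ z ∈ leaves T, z ≠ v → z ≠ w → z ∈ ({x, y} : Set V)) ∧
    (∀ b : V, 3 ≤ deg T b → b ∈ ({x, y} : Set V))

/-- `H` is a Type 1 graph with designated vertices `v, w` (for some choice of `x, y`). -/
def IsType1 {V : Type*} (H : SimpleGraph V) (v w : V) : Prop :=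
  ∃ x y : V, IsType1With H v w x y

/-- `H` is a Type 2 graph with designated vertices `v, w`. -/
structure IsType2 {V : Type*} (H : SimpleGraph V) (v w : V) : Prop where
  ne : v ≠ w
  ham : HasHamPath H v w
  ham_del_or_tree : ∀ (u : V) (hv : v ≠ u) (hw : w ≠ u),
    HasHamPath (del H u) ⟨v, hv⟩ ⟨w, hw⟩ ∨
      ∃ T, IsThreeLeafSpanningTree (del H u) T ∧ ⟨v, hv⟩ ∈ leaves T ∧ ⟨w, hw⟩ ∈ leaves T

/-- The disjoint union of the graphs `H 0, …, H k` together with the edges joining `w i` to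
`v (i + 1)`, the indices being read cyclically (so that `w k` is joined to `v 0`). -/
def cyclicJoin {k : ℕ} {V : Fin (k + 1) → Type*} (H : ∀ i, SimpleGraph (V i)) (v w : ∀ i, V i) :
    SimpleGraph (Σ i, V i) :=
  SimpleGraph.fromRel fun p q =>
    (∃ (i : Fin (k + 1)) (a b : V i), (H i).Adj a b ∧ p = ⟨i, a⟩ ∧ q = ⟨i, b⟩) ∨
    (∃ i : Fin (k + 1), p = ⟨i, w i⟩ ∧ q = ⟨i + 1, v (i + 1)⟩)

end FaultCost

/-! The graph `G` is a ring of blocks, consecutive ones joined by a single edge (a link). Everything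
is measured by the excess deg − 2. A connected graph is a tree exactly when its excesses sum to −2.
Inside one block, the handshake lemma fixes the parity of the excess sum from the number of links
used, and acyclicity bounds that sum from above. Hence degrees alone reveal which links a spanning
tree uses and where its leaves lie (`traversed_block`, `terminal_block`,
`sum_exc_block_of_not_link`). In particular block 0 can never be 2-regular in a spanning tree or
hamiltonian cycle while it is intact, because it would then be crossed by a hamiltonian path from `v
0` to `w 0`. So `G` is not hamiltonian.

Upper bound (`cheap_all`): (ii) in block 0 and hamiltonian paths through the other blocks form a
hamiltonian path `S` of `G` with ends `x` and `y`. For each `u` an optimal subgraph of `G - u` close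
to `S` is glued from pieces. It is a hamiltonian cycle if `u` is an inner vertex of block 0. It is a
hamiltonian path with an end in `{x, y}` if `u` is `v 0`, `w 0` or one of their outside neighbours.
It is a three-leaf tree if `u` ends a link avoiding block 0, and then its block 0 part comes from
(vi). For an inner vertex of another block, the choice depends on whether that block stays
traversable and whether `G - u` is traceable. In every case at most three degrees change.

Lower bound (`exists_costly`): every optimal subgraph of `G` is a hamiltonian path with an end in
block 0. Delete an end of a link between blocks `m` and `m + 1`, neither of them block 0. By
`spanningTree_del_shape`, every spanning tree of the rest has a branch in block 0 and a leaf in each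
of these two blocks. If the hamiltonian path has no end in the two blocks, these are three changed
degrees. For `k ≥ 3` such an `m` exists, because a second end outside block 0 must lie in a block
next to it. For `k = 2` the second end `t` may be unavoidable. Its degree could then stay unchanged
at no further cost only if its block had hamiltonian paths to `t` from both designated vertices,
which is excluded. -/

namespace FaultCost

open SimpleGraph

/-! ### Degree excess, trees, and subgraphs supported on a vertex set -/

section Basic

variable {V : Type*}

/-- The degree of a vertex as an integer (zero for a vertex of infinite degree). -/
noncomputable def dg (T : SimpleGraph V) (a : V) : ℤ := (T.neighborSet a).ncard

open Classical in
/-- The integer truth value of a proposition. -/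
noncomputable def ind (p : Prop) : ℤ := if p then 1 else 0

theorem ind_of {p : Prop} (h : p) : ind p = 1 := if_pos h

theorem ind_not {p : Prop} (h : ¬ p) : ind p = 0 := if_neg h

@[simp] theorem ind_self (a : V) : ind (a = a) = 1 := if_pos rfl

theorem ind_cases (p : Prop) : (p ∧ ind p = 1) ∨ (¬ p ∧ ind p = 0) := by
  by_cases h : p
  · exact Or.inl ⟨h, ind_of h⟩
  · exact Or.inr ⟨h, ind_not h⟩

theorem ind_nonneg (p : Prop) : 0 ≤ ind p := by rcases ind_cases p with h | h <;> omega

theorem ind_le_one (p : Prop) : ind p ≤ 1 := by rcases ind_cases p with h | h <;> omega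

theorem sum_ind_eq [Fintype V] (p : V) : ∑ a, ind (a = p) = 1 := by
  classical simp [ind]

theorem dg_nonneg (T : SimpleGraph V) (a : V) : 0 ≤ dg T a := Int.natCast_nonneg _

theorem deg_eq [Finite V] (T : SimpleGraph V) (a : V) : deg T a = ((dg T a).toNat : ℕ∞) := by
  simp [deg, dg, (Set.toFinite (T.neighborSet a)).cast_ncard_eq]

theorem deg_eq_one_iff [Finite V] {T : SimpleGraph V} {a : V} : deg T a = 1 ↔ dg T a = 1 := by
  rw [deg_eq]
  have := dg_nonneg T a
  norm_cast
  omega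

theorem three_le_deg_iff [Finite V] {T : SimpleGraph V} {a : V} : 3 ≤ deg T a ↔ 3 ≤ dg T a := by
  rw [deg_eq]
  have := dg_nonneg T a
  norm_cast
  omega

theorem deg_eq_deg_iff {W : Type*} [Finite V] [Finite W] {T : SimpleGraph V} {T' : SimpleGraph W}
    {a : V} {b : W} : deg T a = deg T' b ↔ dg T a = dg T' b := by
  rw [deg_eq, deg_eq]
  have := dg_nonneg T a
  have := dg_nonneg T' b
  norm_cast
  omega

theorem dg_pos_of_adj [Finite V] {T : SimpleGraph V} {a b : V} (h : T.Adj a b) : 0 < dg T a := by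
  have : (T.neighborSet a).ncard ≠ 0 := Set.ncard_ne_zero_of_mem (a := b) h
  unfold dg
  omega

theorem dg_pos [Finite V] [Nontrivial V] {T : SimpleGraph V} (h : T.Connected) (a : V) :
    0 < dg T a := by
  obtain ⟨b, hb⟩ := h.preconnected.exists_adj_of_nontrivial a
  exact dg_pos_of_adj hb

theorem dg_eq_degree [Fintype V] (T : SimpleGraph V) [DecidableRel T.Adj] (a : V) :
    dg T a = T.degree a := by
  simp [dg, Set.ncard_eq_toFinset_card', ← SimpleGraph.card_neighborFinset_eq_degree,
    neighborFinset_eq_filter]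

theorem sum_dg [Fintype V] (T : SimpleGraph V) : ∑ a, dg T a = 2 * Nat.card T.edgeSet := by
  classical
  simp_rw [dg_eq_degree]
  rw [Nat.card_eq_fintype_card, ← edgeFinset_card]
  exact_mod_cast T.sum_degrees_eq_twice_card_edges

theorem sum_dg_sub_two [Fintype V] (T : SimpleGraph V) :
    ∑ a, (dg T a - 2) = 2 * Nat.card T.edgeSet - 2 * Nat.card V := by
  rw [Finset.sum_sub_distrib, sum_dg]
  simp
  ring

/-- The excess sum equals 2|E| − 2|V|, so the value −2 says |E| = |V| − 1. -/
theorem isTree_iff_sum [Fintype V] {T : SimpleGraph V} :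
    T.IsTree ↔ T.Connected ∧ ∑ a, (dg T a - 2) = -2 := by
  rw [isTree_iff_connected_and_card, sum_dg_sub_two]
  refine and_congr_right fun _ => ?_
  omega

/-- A forest extends to a spanning tree of the complete graph, which has at least as many edges. -/
theorem sum_le_of_isAcyclic [Fintype V] [Nonempty V] {T : SimpleGraph V} (h : T.IsAcyclic) :
    ∑ a, (dg T a - 2) ≤ -2 := by
  obtain ⟨F, -, hTF, hF⟩ : ∃ F, F ≤ (⊤ : SimpleGraph V) ∧ T ≤ F ∧ F.IsTree := by
    obtain ⟨F, h1, h2, h3⟩ :=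
      (connected_top (V := V)).exists_isTree_le_of_le_of_isAcyclic le_top h
    exact ⟨F, by tauto, by tauto, by tauto⟩
  have h2 := (isTree_iff_sum.1 hF).2
  rw [sum_dg_sub_two] at h2 ⊢
  have : Nat.card T.edgeSet ≤ Nat.card F.edgeSet :=
    Nat.card_mono (Set.toFinite _) (edgeSet_mono hTF)
  omega

/-- All edges of `T` lie within `D`, and `T` connects the nonempty set `D`. -/
structure Spans (T : SimpleGraph V) (D : Set V) : Prop where
  mem : ∀ ⦃a b⦄, T.Adj a b → a ∈ D
  nonempty : D.Nonempty
  reach : ∀ ⦃a⦄, a ∈ D → ∀ ⦃b⦄, b ∈ D → T.Reachable a b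

theorem mem_of_reachable {T : SimpleGraph V} {D : Set V} (h : ∀ ⦃a b⦄, T.Adj a b → a ∈ D) {a b : V}
    (hab : T.Reachable a b) (ha : a ∈ D) : b ∈ D := by
  obtain ⟨p⟩ := hab
  induction p with
  | nil => exact ha
  | cons hadj _ ih => exact ih (h hadj.symm)

theorem reachable_induce {T : SimpleGraph V} {D : Set V} (h : ∀ ⦃a b⦄, T.Adj a b → a ∈ D) {a b : V}
    (hab : T.Reachable a b) (ha : a ∈ D) (hb : b ∈ D) :
    (T.induce D).Reachable ⟨a, ha⟩ ⟨b, hb⟩ := by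
  obtain ⟨p⟩ := hab
  induction p with
  | nil => exact Reachable.refl _
  | cons hadj _ ih =>
    refine Reachable.trans (v := ⟨_, h hadj.symm⟩) (Adj.reachable ?_) (ih (h hadj.symm) hb)
    exact hadj

theorem spans_iff_induce {T : SimpleGraph V} {D : Set V} (h : ∀ ⦃a b⦄, T.Adj a b → a ∈ D) :
    Spans T D ↔ (T.induce D).Connected := by
  constructor
  · intro hT
    obtain ⟨a, ha⟩ := hT.nonempty
    have : Nonempty D := ⟨⟨a, ha⟩⟩
    exact ⟨fun x y => reachable_induce h (hT.reach x.2 y.2) x.2 y.2⟩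
  · intro hT
    obtain ⟨a, ha⟩ := hT.nonempty
    refine ⟨h, ⟨a, ha⟩, fun x hx y hy => ?_⟩
    exact (hT.preconnected ⟨x, hx⟩ ⟨y, hy⟩).map (Embedding.induce D).toHom

theorem spans_univ_iff {T : SimpleGraph V} : Spans T Set.univ ↔ T.Connected := by
  constructor
  · intro h
    have : Nonempty V := ⟨h.nonempty.some⟩
    exact ⟨fun a b => h.reach trivial trivial⟩
  · intro h
    have := h.nonempty
    exact ⟨fun _ _ _ => trivial, Set.univ_nonempty, fun a _ b _ => h.preconnected a b⟩

theorem dg_induce {T : SimpleGraph V} {D : Set V} (h : ∀ ⦃a b⦄, T.Adj a b → a ∈ D) (z : D) :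
    dg (T.induce D) z = dg T z := by
  unfold dg
  rw [← Set.ncard_image_of_injective _ Subtype.val_injective]
  congr 2
  ext b
  constructor
  · rintro ⟨c, hc, rfl⟩
    exact hc
  · intro hb
    exact ⟨⟨b, h (Adj.symm hb)⟩, hb, rfl⟩

/-- This allows subgraphs of `G - u` to be treated as graphs on all of `V` in which `u` is isolated,
so degrees can be compared without changing the vertex type. -/
theorem exists_extension {G : SimpleGraph V} {D : Set V} {T' : SimpleGraph D}
    (h : T' ≤ G.induce D) :
    ∃ T ≤ G, (∀ ⦃a b⦄, T.Adj a b → a ∈ D) ∧ T.induce D = T' := by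
  refine ⟨T'.spanningCoe, ?_, ?_, induce_spanningCoe⟩
  · rintro a b ⟨-, a', b', hab, rfl, rfl⟩
    exact h hab
  · rintro a b ⟨-, a', b', hab, rfl, rfl⟩
    exact a'.2

open Classical in
/-- The excess of the degree of a vertex of `D` over 2. -/
noncomputable def exc (T : SimpleGraph V) (D : Set V) (a : V) : ℤ := if a ∈ D then dg T a - 2 else 0

theorem exc_mem (T : SimpleGraph V) {D : Set V} {a : V} (h : a ∈ D) : exc T D a = dg T a - 2 :=
  if_pos h

theorem exc_notMem (T : SimpleGraph V) {D : Set V} {a : V} (h : a ∉ D) : exc T D a = 0 := if_neg h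

theorem sum_exc [Fintype V] {T : SimpleGraph V} {D : Set V} [Fintype D]
    (h : ∀ ⦃a b⦄, T.Adj a b → a ∈ D) :
    ∑ a, exc T D a = ∑ z : D, (dg (T.induce D) z - 2) := by
  classical
  simp_rw [dg_induce h]
  unfold exc
  rw [← Finset.sum_filter]
  exact Finset.sum_subtype _ (by simp) (fun a => dg T a - 2)

theorem even_sum_exc [Fintype V] {T : SimpleGraph V} {D : Set V}
    (h : ∀ ⦃a b⦄, T.Adj a b → a ∈ D) : Even (∑ a, exc T D a) := by
  have := Fintype.ofFinite D
  rw [sum_exc h, sum_dg_sub_two, ← mul_sub]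
  exact even_two_mul _

theorem sum_exc_le [Fintype V] {T : SimpleGraph V} {D : Set V} (hD : D.Nonempty)
    (h : ∀ ⦃a b⦄, T.Adj a b → a ∈ D) (hT : T.IsAcyclic) : ∑ a, exc T D a ≤ -2 := by
  have := Fintype.ofFinite D
  have : Nonempty D := hD.to_subtype
  rw [sum_exc h]
  exact sum_le_of_isAcyclic (hT.induce D)

theorem isTree_induce_iff [Fintype V] {T : SimpleGraph V} {D : Set V}
    (h : ∀ ⦃a b⦄, T.Adj a b → a ∈ D) :
    (T.induce D).IsTree ↔ Spans T D ∧ ∑ a, exc T D a = -2 := by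
  have := Fintype.ofFinite D
  rw [isTree_iff_sum, sum_exc h, spans_iff_induce h]

/-- Every vertex of a cycle carries an edge, so the whole cycle lies in `D`. -/
theorem isAcyclic_of_induce {T : SimpleGraph V} {D : Set V} (h : ∀ ⦃a b⦄, T.Adj a b → a ∈ D)
    (hT : (T.induce D).IsAcyclic) : T.IsAcyclic := by
  classical
  intro a p hp
  have hmem : ∀ x ∈ p.support, x ∈ D := by
    intro x hx
    have ha : a ∈ D := by
      cases p with
      | nil => exact absurd rfl hp.ne_nil
      | cons hadj _ => exact h hadj
    exact mem_of_reachable h (p.takeUntil x hx).reachable ha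
  refine hT (p.induce D hmem) ?_
  rw [← Walk.isCycle_map_iff_of_injective (f := (Embedding.induce D).toHom) Subtype.val_injective]
  simpa using hp

end Basic

/-! ### Hamiltonian paths and cycles as connected graphs with prescribed degrees -/

section Hamiltonian

variable {V : Type*}

theorem spanningCoe_toSubgraph_reachable {G : SimpleGraph V} {a b : V} (p : G.Walk a b) {x y : V}
    (hx : x ∈ p.support) (hy : y ∈ p.support) : p.toSubgraph.spanningCoe.Reachable x y := by
  have h := p.toSubgraph_connected.coe.preconnected ⟨x, p.mem_verts_toSubgraph.2 hx⟩
    ⟨y, p.mem_verts_toSubgraph.2 hy⟩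
  exact h.map (⟨Subtype.val, fun h => h⟩ : p.toSubgraph.coe →g p.toSubgraph.spanningCoe)

/-- Adding the two indicators keeps the equation valid for the one-vertex path, where `a = b` has
degree 0. -/
theorem dg_toSubgraph_of_isPath {G : SimpleGraph V} {a b : V} {p : G.Walk a b} (hp : p.IsPath)
    {u : V} (hu : u ∈ p.support) :
    dg p.toSubgraph.spanningCoe u + ind (u = a) + ind (u = b) = 2 := by
  have hdg : dg p.toSubgraph.spanningCoe u = (p.toSubgraph.neighborSet u).ncard := rfl
  rw [hdg]
  by_cases hn : p.Nil
  · obtain rfl := hn.eq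
    obtain rfl : p = Walk.nil := Walk.eq_nil_iff_nil.2 hn
    obtain rfl : u = a := by simpa using hu
    simp [ind]
  have hab : a ≠ b := fun h => by
    subst h
    exact hn (Walk.isPath_iff_nil.1 hp)
  by_cases ha : u = a
  · subst ha
    rw [hp.neighborSet_toSubgraph_startpoint hn, Set.ncard_singleton, ind_self, ind_not hab]
    rfl
  by_cases hb : u = b
  · subst hb
    rw [hp.neighborSet_toSubgraph_endpoint hn, Set.ncard_singleton, ind_self, ind_not ha]
    rfl
  obtain ⟨i, rfl, hi⟩ := Walk.mem_support_iff_exists_getVert.1 hu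
  rw [hp.ncard_neighborSet_toSubgraph_internal_eq_two, ind_not ha, ind_not hb]
  · rfl
  · rintro rfl
    simp at ha
  · refine lt_of_le_of_ne hi ?_
    rintro rfl
    simp at hb

theorem neighborSet_eq_of_dg_eq [Finite V] {T T' : SimpleGraph V} (h : T ≤ T') {u : V}
    (hd : dg T' u ≤ dg T u) : T.neighborSet u = T'.neighborSet u :=
  Set.eq_of_subset_of_ncard_le (fun _ hb => h hb) (by unfold dg at hd; omega)

theorem dg_mono [Finite V] {T T' : SimpleGraph V} (h : T ≤ T') (u : V) : dg T u ≤ dg T' u := by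
  unfold dg
  exact_mod_cast Set.ncard_le_ncard (t := T'.neighborSet u) (fun _ hb => h hb) (Set.toFinite _)

/-- Conversely, any path from `a` to `b` in `T` already uses up the `T`-degree of each of its
vertices, so no edge of `T` leaves it and connectedness makes it spanning. -/
theorem hasHamPath_iff [Finite V] {G : SimpleGraph V} {a b : V} :
    HasHamPath G a b ↔
      ∃ T ≤ G, T.Connected ∧ ∀ u, dg T u + ind (u = a) + ind (u = b) = 2 := by
  classical
  constructor
  · rintro ⟨p, hp⟩
    refine ⟨_, p.toSubgraph.spanningCoe_le, ?_, fun u => dg_toSubgraph_of_isPath hp.isPath (hp.mem_support u)⟩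
    have : Nonempty V := ⟨a⟩
    exact ⟨fun x y => spanningCoe_toSubgraph_reachable p (hp.mem_support x) (hp.mem_support y)⟩
  · rintro ⟨T, hTG, hT, hd⟩
    obtain ⟨p, hp⟩ := (hT.preconnected a b).exists_isPath
    have hle : p.toSubgraph.spanningCoe ≤ T := p.toSubgraph.spanningCoe_le
    have hcl : ∀ {x y}, T.Adj x y → x ∈ p.support → y ∈ p.support := by
      intro x y hxy hx
      have h1 := dg_toSubgraph_of_isPath hp hx
      have h2 := neighborSet_eq_of_dg_eq hle (u := x) (by have := hd x; omega)
      have h3 : p.toSubgraph.Adj x y := by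
        have : y ∈ p.toSubgraph.spanningCoe.neighborSet x := h2 ▸ hxy
        exact this
      exact Walk.mem_support_of_adj_toSubgraph h3.symm
    have hall : ∀ w, w ∈ p.support := by
      intro w
      obtain ⟨q⟩ := hT.preconnected a w
      have : ∀ {x y} (q : T.Walk x y), x ∈ p.support → y ∈ p.support := by
        intro x y q
        induction q with
        | nil => exact id
        | cons h _ ih => exact fun hx => ih (hcl h hx)
      exact this q p.start_mem_support
    refine ⟨p.mapLe hTG, ?_⟩
    refine Walk.IsPath.isHamiltonian_of_mem (hp.mapLe hTG) fun w => ?_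
    simpa using hall w

theorem isHamCycle_iff [Finite V] {G C : SimpleGraph V} :
    IsHamCycle G C ↔ C ≤ G ∧ C.Connected ∧ ∀ u, dg C u = 2 := by
  classical
  constructor
  · rintro ⟨a, p, hp, hC⟩
    have hc := hp.isCycle
    have hs := hp.mem_support
    have hCe : C = p.toSubgraph.spanningCoe := by
      ext x y
      rw [Subgraph.spanningCoe_adj, Walk.adj_toSubgraph_iff_mem_edges, ← mem_edgeSet, hC]
      rfl
    subst hCe
    have : Nonempty V := ⟨a⟩
    refine ⟨p.toSubgraph.spanningCoe_le,
      ⟨fun x y => spanningCoe_toSubgraph_reachable p (hs x) (hs y)⟩, fun u => ?_⟩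
    have := hc.ncard_neighborSet_toSubgraph_eq_two (hs u)
    unfold dg
    exact_mod_cast this
  · rintro ⟨hCG, hC, hd⟩
    obtain ⟨a⟩ := hC.nonempty
    have hcyc : C.IsCycles := fun v _ => by
      have := hd v
      unfold dg at this
      exact_mod_cast this
    obtain ⟨p, hp, hv⟩ := hcyc.exists_cycle_toSubgraph_verts_eq_connectedComponentSupp
      (c := C.connectedComponentMk a) (v := a) rfl (by
        refine Set.nonempty_of_ncard_ne_zero ?_
        have := hd a
        unfold dg at this
        omega)
    have hs : ∀ w, w ∈ p.support := fun w => by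
      rw [← Walk.mem_verts_toSubgraph, hv]
      exact ConnectedComponent.sound (hC.preconnected w a)
    refine ⟨a, p.mapLe hCG, ?_, ?_⟩
    · rw [Walk.isHamiltonianCycle_iff_isCycle_and_support_count_tail_eq_one]
      refine ⟨hp.mapLe hCG, fun w => ?_⟩
      have hnd : p.support.tail.Nodup := hp.support_nodup
      have hmem : w ∈ p.support.tail := by
        rcases (Walk.mem_support_iff p).1 (hs w) with rfl | h
        · exact Walk.end_mem_tail_support hp.not_nil
        · exact h
      simpa using List.count_eq_one_of_mem hnd hmem
    · ext e
      induction e with | _ x y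
      have hn : p.toSubgraph.spanningCoe.neighborSet x = C.neighborSet x := by
        refine neighborSet_eq_of_dg_eq p.toSubgraph.spanningCoe_le ?_
        have : ((p.toSubgraph.neighborSet x).ncard : ℤ) = 2 := by
          exact_mod_cast hp.ncard_neighborSet_toSubgraph_eq_two (hs x)
        exact (hd x).trans_le this.ge
      have : p.toSubgraph.Adj x y ↔ C.Adj x y := by
        have := Set.ext_iff.1 hn y
        exact this
      rw [mem_edgeSet, ← this, Walk.adj_toSubgraph_iff_mem_edges]
      simp

theorem isHam_iff [Finite V] {G : SimpleGraph V} :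
    IsHam G ↔ ∃ C ≤ G, C.Connected ∧ ∀ u, dg C u = 2 := by
  simp only [IsHam, isHamCycle_iff]

theorem hasHamPath_del_iff [Finite V] {G : SimpleGraph V} {u a b : V} {ha : a ∈ ({u}ᶜ : Set V)}
    {hb : b ∈ ({u}ᶜ : Set V)} :
    HasHamPath (del G u) ⟨a, ha⟩ ⟨b, hb⟩ ↔
      ∃ T ≤ G, Spans T {u}ᶜ ∧ ∀ z ≠ u, dg T z + ind (z = a) + ind (z = b) = 2 := by
  rw [hasHamPath_iff]
  constructor
  · rintro ⟨T', hle, hT, hd⟩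
    obtain ⟨T, hTG, hm, rfl⟩ := exists_extension hle
    refine ⟨T, hTG, (spans_iff_induce hm).2 hT, fun z hz => ?_⟩
    have := hd ⟨z, Set.mem_compl_singleton_iff.2 hz⟩
    rwa [dg_induce hm, Subtype.mk_eq_mk, Subtype.mk_eq_mk] at this
  · rintro ⟨T, hTG, hT, hd⟩
    refine ⟨T.induce _, comap_monotone _ hTG, (spans_iff_induce hT.mem).1 hT, fun z => ?_⟩
    rw [dg_induce hT.mem, Subtype.ext_iff, Subtype.ext_iff]
    exact hd z z.2

theorem isHam_del_iff [Finite V] {G : SimpleGraph V} {u : V} :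
    IsHam (del G u) ↔ ∃ C ≤ G, Spans C {u}ᶜ ∧ ∀ z ≠ u, dg C z = 2 := by
  rw [isHam_iff]
  constructor
  · rintro ⟨T', hle, hT, hd⟩
    obtain ⟨T, hTG, hm, rfl⟩ := exists_extension hle
    refine ⟨T, hTG, (spans_iff_induce hm).2 hT, fun z hz => ?_⟩
    have := hd ⟨z, hz⟩
    rwa [dg_induce hm] at this
  · rintro ⟨T, hTG, hT, hd⟩
    refine ⟨T.induce _, comap_monotone _ hTG, (spans_iff_induce hT.mem).1 hT, fun z => ?_⟩
    rw [dg_induce hT.mem]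
    exact hd z z.2

end Hamiltonian

/-! ### Minimum leaf number, and degree profiles of trees with two or three leaves -/

section LeafNumber

variable {V : Type*}

/-- A spanning 2-regular subgraph makes every excess nonnegative, against the sum −2. -/
theorem IsHam.not_isTree [Finite V] {T : SimpleGraph V} (h : IsHam T) : ¬ T.IsTree := by
  have := Fintype.ofFinite V
  rw [isHam_iff] at h
  obtain ⟨C, hCT, -, hd⟩ := h
  intro hT
  have h1 := (isTree_iff_sum.1 hT).2
  have h2 : 0 ≤ ∑ a, (dg T a - 2) := Finset.sum_nonneg fun a _ => by
    have := dg_mono hCT a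
    have := hd a
    omega
  omega

/-- A tree is minimally connected, so it is its own only spanning tree. -/
theorem ml_of_isTree [Finite V] {T : SimpleGraph V} (hT : T.IsTree) : ml T = leafNumber T := by
  rw [ml, if_neg fun h => h.not_isTree hT]
  refine le_antisymm (iInf₂_le T ⟨le_rfl, hT⟩) (le_iInf₂ fun T' hT' => ?_)
  rw [le_antisymm hT'.1 ((isTree_iff_minimal_connected.1 hT).2 hT'.2.1 hT'.1)]

theorem IsHamCycle.mem_mlSubgraphs [Finite V] {G C : SimpleGraph V} (h : IsHamCycle G C) :
    C ∈ mlSubgraphs G := by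
  refine ⟨Or.inr h, ?_⟩
  have hC : IsHam C := ⟨C, by rw [isHamCycle_iff] at h ⊢; exact ⟨le_rfl, h.2⟩⟩
  rw [ml, if_pos hC, ml, if_pos ⟨C, h⟩]

theorem mem_mlSubgraphs_of_minimal [Finite V] {G T : SimpleGraph V} (hG : ¬ IsHam G)
    (hT : IsSpanningTree G T) (hmin : ∀ T', IsSpanningTree G T' → leafNumber T ≤ leafNumber T') :
    T ∈ mlSubgraphs G := by
  refine ⟨Or.inl hT, ?_⟩
  rw [ml_of_isTree hT.2, ml, if_neg hG]
  exact le_antisymm (le_iInf₂ hmin) (iInf₂_le T hT)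

theorem isSpanningTree_of_mem_mlSubgraphs [Finite V] {G T : SimpleGraph V} (hG : ¬ IsHam G)
    (hT : T ∈ mlSubgraphs G) :
    IsSpanningTree G T ∧ ∀ T', IsSpanningTree G T' → leafNumber T ≤ leafNumber T' := by
  have h : IsSpanningTree G T := hT.1.resolve_right fun h => hG ⟨T, h⟩
  refine ⟨h, fun T' hT' => ?_⟩
  rw [← ml_of_isTree h.2, hT.2, ml, if_neg hG]
  exact iInf₂_le T' hT'

theorem sum_indicator_of_sum_eq_one [Fintype V] {f : V → ℤ} (h0 : ∀ a, 0 ≤ f a)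
    (h1 : ∑ a, f a = 1) : ∃ b, ∀ a, f a = ind (a = b) := by
  classical
  obtain ⟨b, -, hb⟩ : ∃ b ∈ Finset.univ, f b ≠ 0 := Finset.exists_ne_zero_of_sum_ne_zero (by omega)
  have h2 := Finset.add_sum_erase Finset.univ f (Finset.mem_univ b)
  have h3 : 0 ≤ ∑ a ∈ Finset.univ.erase b, f a := Finset.sum_nonneg fun a _ => h0 a
  have h4 := h0 b
  have h5 : ∑ a ∈ Finset.univ.erase b, f a = 0 := by omega
  refine ⟨b, fun a => ?_⟩
  by_cases hab : a = b
  · subst hab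
    rw [ind_self]
    omega
  · rw [ind_not hab]
    exact (Finset.sum_eq_zero_iff_of_nonneg fun a _ => h0 a).1 h5 a (by simp [hab])

theorem mem_leaves_iff [Finite V] {T : SimpleGraph V} {a : V} : a ∈ leaves T ↔ dg T a = 1 :=
  deg_eq_one_iff

theorem nontrivial_of_mem_leaves [Finite V] {T : SimpleGraph V} {a : V} (h : a ∈ leaves T) :
    Nontrivial V := by
  rw [mem_leaves_iff] at h
  have : (T.neighborSet a).Nonempty := Set.nonempty_of_ncard_ne_zero (by unfold dg at h; omega)
  obtain ⟨b, hb⟩ := this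
  exact ⟨a, b, hb.ne⟩

theorem two_le_leafNumber [Finite V] [Nontrivial V] {T : SimpleGraph V} (hT : T.IsTree) :
    2 ≤ leafNumber T := by
  classical
  have := Fintype.ofFinite V
  by_contra! hlt
  have hs := (isTree_iff_sum.1 hT).2
  have hsub : (leaves T).Subsingleton := by
    rw [← Set.encard_le_one_iff_subsingleton]
    exact Order.le_of_lt_succ hlt
  obtain ⟨b, hb⟩ : ∃ b, ∀ a ∈ leaves T, a = b := by
    rcases hsub.eq_empty_or_singleton with h | ⟨b, h⟩
    · exact ⟨Classical.arbitrary V, by simp [h]⟩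
    · exact ⟨b, by simp [h]⟩
  have : ∑ a, (- ind (a = b)) ≤ ∑ a, (dg T a - 2) := Finset.sum_le_sum fun a _ => by
    have h1 := dg_pos hT.1 a
    rcases ind_cases (a = b) with h | h
    · omega
    · have : dg T a ≠ 1 := fun h' => h.1 (hb a (mem_leaves_iff.2 h'))
      omega
  rw [Finset.sum_neg_distrib, sum_ind_eq] at this
  omega

/-- Once the two leaves are compensated by indicators, all excesses are nonnegative and sum to 0, so
they vanish. -/
theorem exists_profile_of_leafNumber_eq_two [Finite V] {T : SimpleGraph V} (hT : T.IsTree)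
    (h : leafNumber T = 2) :
    ∃ l₁ l₂, l₁ ≠ l₂ ∧ ∀ z, dg T z + ind (z = l₁) + ind (z = l₂) = 2 := by
  have := Fintype.ofFinite V
  obtain ⟨l₁, l₂, hne, hl⟩ := Set.encard_eq_two.1 h
  have hmem : ∀ a, a ∈ leaves T ↔ a = l₁ ∨ a = l₂ := fun a => by rw [hl]; rfl
  have := nontrivial_of_mem_leaves ((hmem l₁).2 (Or.inl rfl))
  have h0 : ∀ a ∈ Finset.univ, 0 ≤ dg T a - 2 + ind (a = l₁) + ind (a = l₂) := fun a _ => by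
    have h1 := dg_pos hT.1 a
    have h2 := hmem a
    rw [mem_leaves_iff] at h2
    rcases ind_cases (a = l₁) with h3 | h3 <;> rcases ind_cases (a = l₂) with h4 | h4 <;> grind
  have hs : ∑ a, (dg T a - 2 + ind (a = l₁) + ind (a = l₂)) = 0 := by
    rw [Finset.sum_add_distrib, Finset.sum_add_distrib, (isTree_iff_sum.1 hT).2, sum_ind_eq,
      sum_ind_eq]
    rfl
  refine ⟨l₁, l₂, hne, fun z => ?_⟩
  have := (Finset.sum_eq_zero_iff_of_nonneg h0).1 hs z (Finset.mem_univ z)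
  omega

/-- After compensating the three leaves, the nonnegative excesses sum to 1, so exactly one vertex
carries it: the branch. -/
theorem exists_profile_of_leafNumber_eq_three [Finite V] {T : SimpleGraph V} (hT : T.IsTree)
    (h : leafNumber T = 3) {l₁ l₂ : V} (h1 : l₁ ∈ leaves T) (h2 : l₂ ∈ leaves T) (h12 : l₁ ≠ l₂) :
    ∃ l₃ b, l₃ ∈ leaves T ∧ 3 ≤ deg T b ∧ l₁ ≠ l₃ ∧ l₂ ≠ l₃ ∧ l₁ ≠ b ∧ l₂ ≠ b ∧ l₃ ≠ b ∧
      ∀ z, dg T z + ind (z = l₁) + ind (z = l₂) + ind (z = l₃) = 2 + ind (z = b) := by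
  have := Fintype.ofFinite V
  have := nontrivial_of_mem_leaves h1
  obtain ⟨l₃, h3, h31, h32, hall⟩ : ∃ l₃ ∈ leaves T, l₃ ≠ l₁ ∧ l₃ ≠ l₂ ∧
      ∀ a, a ∈ leaves T → a = l₁ ∨ a = l₂ ∨ a = l₃ := by
    obtain ⟨x, y, z, hxy, hxz, hyz, hs⟩ := Set.encard_eq_three.1 h
    rw [hs] at h1 h2 ⊢
    simp only [Set.mem_insert_iff, Set.mem_singleton_iff, exists_eq_or_imp, exists_eq_left] at *
    grind
  have h0 : ∀ a, 0 ≤ dg T a - 2 + ind (a = l₁) + ind (a = l₂) + ind (a = l₃) := fun a => by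
    have h1 := dg_pos hT.1 a
    have h2 := hall a
    rw [mem_leaves_iff] at h2
    rcases ind_cases (a = l₁) with h3 | h3 <;> rcases ind_cases (a = l₂) with h4 | h4 <;>
      rcases ind_cases (a = l₃) with h5 | h5 <;> grind
  have hs : ∑ a, (dg T a - 2 + ind (a = l₁) + ind (a = l₂) + ind (a = l₃)) = 1 := by
    rw [Finset.sum_add_distrib, Finset.sum_add_distrib, Finset.sum_add_distrib,
      (isTree_iff_sum.1 hT).2, sum_ind_eq, sum_ind_eq, sum_ind_eq]
    rfl
  obtain ⟨b, hb⟩ := sum_indicator_of_sum_eq_one h0 hs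
  rw [mem_leaves_iff] at h1 h2
  have h3' := mem_leaves_iff.1 h3
  have e1 := hb l₁
  have e2 := hb l₂
  have e3 := hb l₃
  have eb := hb b
  rw [ind_self, ind_not h12, ind_not h31.symm] at e1
  rw [ind_self, ind_not h12.symm, ind_not h32.symm] at e2
  rw [ind_self, ind_not h31, ind_not h32] at e3
  rw [ind_self] at eb
  have n1 : l₁ ≠ b := fun h => by rw [ind_of h] at e1; omega
  have n2 : l₂ ≠ b := fun h => by rw [ind_of h] at e2; omega
  have n3 : l₃ ≠ b := fun h => by rw [ind_of h] at e3; omega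
  rw [ind_not n1.symm, ind_not n2.symm, ind_not n3.symm] at eb
  refine ⟨l₃, b, h3, three_le_deg_iff.2 (by omega), h31.symm, h32.symm, n1, n2, n3, fun z => ?_⟩
  have := hb z
  omega

theorem leafNumber_of_profile_two [Finite V] {T : SimpleGraph V} {l₁ l₂ : V} (hne : l₁ ≠ l₂)
    (h : ∀ z, dg T z + ind (z = l₁) + ind (z = l₂) = 2) : leafNumber T = 2 := by
  refine Set.encard_eq_two.2 ⟨l₁, l₂, hne, ?_⟩
  ext a
  rw [mem_leaves_iff, Set.mem_insert_iff, Set.mem_singleton_iff]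
  have := h a
  rcases ind_cases (a = l₁) with ⟨rfl, h3⟩ | h3 <;> rcases ind_cases (a = l₂) with h4 | h4
  all_goals grind

theorem leafNumber_of_profile_three [Finite V] {T : SimpleGraph V} {l₁ l₂ l₃ b : V} (h12 : l₁ ≠ l₂)
    (h13 : l₁ ≠ l₃) (h23 : l₂ ≠ l₃) (h1b : l₁ ≠ b) (h2b : l₂ ≠ b) (h3b : l₃ ≠ b)
    (h : ∀ z, dg T z + ind (z = l₁) + ind (z = l₂) + ind (z = l₃) = 2 + ind (z = b)) :
    leafNumber T = 3 := by
  refine Set.encard_eq_three.2 ⟨l₁, l₂, l₃, h12, h13, h23, ?_⟩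
  ext a
  rw [mem_leaves_iff, Set.mem_insert_iff, Set.mem_insert_iff, Set.mem_singleton_iff]
  have := h a
  rcases ind_cases (a = l₁) with h3 | h3 <;> rcases ind_cases (a = l₂) with h4 | h4 <;>
    rcases ind_cases (a = l₃) with h5 | h5 <;> rcases ind_cases (a = b) with h6 | h6 <;>
    grind

end LeafNumber

/-! ### A parity criterion for connectedness -/

section Parity

variable {V : Type*}

/-- If `p` and `q` were in different components, `p` would be the only vertex of odd degree in its
component. -/
theorem spans_of_reachable_or [Finite V] {R : SimpleGraph V} {D : Set V} {p q : V} (hp : p ∈ D) (hm : ∀ ⦃a b⦄, R.Adj a b → a ∈ D)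
    (hd : ∀ a ∈ D, dg R a + ind (a = p) + ind (a = q) = 2)
    (hr : ∀ a ∈ D, R.Reachable a p ∨ R.Reachable a q) : Spans R D := by
  have := Fintype.ofFinite V
  have hpq : R.Reachable p q := by
    by_contra hpq
    let K : Set V := {a | R.Reachable a p}
    -- The component of `p` taken as a separate graph; its excess sum is −1, contradicting the
    -- handshake lemma.
    let R' : SimpleGraph V :=
      { Adj := fun a b => R.Adj a b ∧ a ∈ K
        symm := ⟨fun a b h => ⟨h.1.symm, h.1.symm.reachable.trans h.2⟩⟩
        loopless := ⟨fun a h => h.1.ne rfl⟩ }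
    have hdg : ∀ a ∈ K, dg R' a = dg R a := fun a ha => by
      have : R'.neighborSet a = R.neighborSet a := by
        ext b
        exact ⟨fun h => h.1, fun h => ⟨h, ha⟩⟩
      rw [dg, this, dg]
    have he := even_sum_exc (T := R') (D := K) fun a b h => h.2
    have hs : ∑ a, exc R' K a = ∑ a, (- ind (a = p)) := by
      refine Finset.sum_congr rfl fun a _ => ?_
      by_cases ha : a ∈ K
      · have haD : a ∈ D := mem_of_reachable hm (Reachable.symm ha) hp
        have haq : a ≠ q := fun h => hpq (Reachable.symm (h ▸ ha))
        have := hd a haD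
        rw [ind_not haq] at this
        rw [exc_mem _ ha, hdg a ha]
        omega
      · have hap : a ≠ p := fun h => ha (h ▸ Reachable.refl _)
        rw [exc_notMem _ ha, ind_not hap]
        rfl
    rw [hs, Finset.sum_neg_distrib, sum_ind_eq] at he
    exact absurd he (by decide)
  have hall : ∀ a ∈ D, R.Reachable a p := fun a ha => (hr a ha).elim id fun h => h.trans hpq.symm
  exact ⟨hm, ⟨p, hp⟩, fun a ha b hb => (hall a ha).trans (hall b hb).symm⟩

end Parity

/-! ### The ring of blocks: links, and excess sums within a block -/

section Blocks

variable {k : ℕ} {V : Fin (k + 1) → Type*}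

/-- The restriction of a graph on the disjoint union to one block. -/
abbrev blk (T : SimpleGraph (Σ i, V i)) (j : Fin (k + 1)) : SimpleGraph (V j) :=
  T.comap (Sigma.mk j)

/-- `T` contains the edge from the exit of block `j` to the entry of block `j + 1`. -/
def Link (v w : ∀ i, V i) (T : SimpleGraph (Σ i, V i)) (j : Fin (k + 1)) : Prop :=
  T.Adj ⟨j, w j⟩ ⟨j + 1, v (j + 1)⟩

/-- The part of a vertex set lying in block `j`. -/
abbrev part (D : Set (Σ i, V i)) (j : Fin (k + 1)) : Set (V j) := Sigma.mk j ⁻¹' D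

variable {H : ∀ i, SimpleGraph (V i)} {v w : ∀ i, V i} {T : SimpleGraph (Σ i, V i)}
  {D : Set (Σ i, V i)}

theorem link_sub_one {j : Fin (k + 1)} :
    Link v w T (j - 1) ↔ T.Adj ⟨j - 1, w (j - 1)⟩ ⟨j, v j⟩ := by
  have : (⟨j - 1 + 1, v (j - 1 + 1)⟩ : Σ i, V i) = ⟨j, v j⟩ :=
    congrArg (fun i => (⟨i, v i⟩ : Σ i, V i)) (sub_add_cancel j 1)
  rw [Link, this]

theorem cyclicJoin_adj_cases {p q : Σ i, V i} (h : (cyclicJoin H v w).Adj p q) :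
    (∃ j a b, (H j).Adj a b ∧ p = ⟨j, a⟩ ∧ q = ⟨j, b⟩) ∨
    (∃ j, p = ⟨j, w j⟩ ∧ q = ⟨j + 1, v (j + 1)⟩) ∨
    (∃ j, q = ⟨j, w j⟩ ∧ p = ⟨j + 1, v (j + 1)⟩) := by
  obtain ⟨-, (h | h) | (⟨j, a, b, h, h1, h2⟩ | h)⟩ := h
  · exact Or.inl h
  · exact Or.inr (Or.inl h)
  · exact Or.inl ⟨j, b, a, h.symm, h2, h1⟩
  · exact Or.inr (Or.inr h)

theorem cyclicJoin_adj_of_adj {j : Fin (k + 1)} {a b : V j} (h : (H j).Adj a b) :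
    (cyclicJoin H v w).Adj ⟨j, a⟩ ⟨j, b⟩ := by
  refine ⟨fun h' => h.ne ?_, Or.inl (Or.inl ⟨j, a, b, h, rfl, rfl⟩)⟩
  simpa using h'

theorem add_one_ne_self (hk : 2 ≤ k) (j : Fin (k + 1)) : j + 1 ≠ j := by
  have : NeZero k := ⟨by omega⟩
  intro h
  have := congrArg Fin.val (show (1 : Fin (k + 1)) = 0 from by simpa only [add_eq_left] using h)
  rw [Fin.val_one'] at this
  rw [Nat.mod_eq_of_lt (by omega)] at this
  simp at this

theorem sub_one_ne_self (hk : 2 ≤ k) (j : Fin (k + 1)) : j - 1 ≠ j := fun h =>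
  add_one_ne_self hk (j - 1) (by rw [sub_add_cancel]; exact h.symm)

theorem add_one_ne_sub_one (hk : 2 ≤ k) (j : Fin (k + 1)) : j + 1 ≠ j - 1 := by
  intro h
  have h1 : (1 : Fin (k + 1)) + 1 = 0 := by
    have : j + 1 + 1 = j := by rw [h, sub_add_cancel]
    simpa [add_assoc] using this
  have := congrArg Fin.val h1
  rw [Fin.val_add, Fin.val_one', Nat.mod_eq_of_lt (a := 1) (by omega),
    Nat.mod_eq_of_lt (by omega)] at this
  simp at this

theorem blk_cyclicJoin (hk : 2 ≤ k) (j : Fin (k + 1)) : blk (cyclicJoin H v w) j = H j := by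
  ext a b
  refine ⟨fun h => ?_, cyclicJoin_adj_of_adj⟩
  rcases cyclicJoin_adj_cases h with ⟨i, a', b', h, h1, h2⟩ | ⟨i, h1, h2⟩ | ⟨i, h1, h2⟩
  · cases h1
    cases h2
    exact h
  · have e1 : j = i := congrArg Sigma.fst h1
    have e2 : j = i + 1 := congrArg Sigma.fst h2
    exact absurd (e2.symm.trans e1) (add_one_ne_self hk i)
  · have e1 : j = i := congrArg Sigma.fst h1
    have e2 : j = i + 1 := congrArg Sigma.fst h2
    exact absurd (e2.symm.trans e1) (add_one_ne_self hk i)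

theorem blk_le (hk : 2 ≤ k) (hT : T ≤ cyclicJoin H v w) (j : Fin (k + 1)) : blk T j ≤ H j := by
  rw [← blk_cyclicJoin (H := H) (v := v) (w := w) hk j]
  exact fun a b h => hT h

theorem neighborSet_eq (hT : T ≤ cyclicJoin H v w) (j : Fin (k + 1)) (a : V j) :
    T.neighborSet ⟨j, a⟩ = Sigma.mk j '' (blk T j).neighborSet a ∪
      {y | y = ⟨j + 1, v (j + 1)⟩ ∧ a = w j ∧ Link v w T j} ∪
      {y | y = ⟨j - 1, w (j - 1)⟩ ∧ a = v j ∧ Link v w T (j - 1)} := by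
  ext y
  simp only [mem_neighborSet, Set.mem_union, Set.mem_image, Set.mem_ofPred_eq, comap_adj]
  constructor
  · intro h
    rcases cyclicJoin_adj_cases (hT h) with ⟨i, a', b', -, h1, rfl⟩ | ⟨i, h1, rfl⟩ | ⟨i, rfl, h2⟩
    · cases h1
      exact Or.inl (Or.inl ⟨b', h, rfl⟩)
    · cases h1
      exact Or.inl (Or.inr ⟨rfl, rfl, h⟩)
    · obtain rfl : j = i + 1 := congrArg Sigma.fst h2
      obtain rfl : a = v (i + 1) := by simpa using h2
      have hi : i + 1 - 1 = i := add_sub_cancel_right i 1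
      refine Or.inr ⟨(congrArg (fun i => (⟨i, w i⟩ : Σ i, V i)) hi).symm, rfl, ?_⟩
      rw [hi]
      exact h.symm
  · rintro ((⟨b, h, rfl⟩ | ⟨rfl, rfl, h⟩) | ⟨rfl, rfl, h⟩)
    · exact h
    · exact h
    · exact (link_sub_one.1 h).symm

theorem ncard_setOf_eq_and {X : Type*} (c : X) (p : Prop) :
    (({y | y = c ∧ p} : Set X).ncard : ℤ) = ind p := by
  by_cases h : p
  · simp [h, ind]
  · simp [h, ind]

theorem mem_of_link (hm : ∀ ⦃a b⦄, T.Adj a b → a ∈ D) {j : Fin (k + 1)} (h : Link v w T j) :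
    w j ∈ part D j := hm h

theorem mem_of_link_sub_one (hm : ∀ ⦃a b⦄, T.Adj a b → a ∈ D) {j : Fin (k + 1)}
    (h : Link v w T (j - 1)) : v j ∈ part D j := hm (link_sub_one.1 h).symm

/-- Follow a walk until it first leaves the block: up to that point it stays inside, and the only
two exits are the links. -/
theorem reachable_exit (hT : T ≤ cyclicJoin H v w) {j : Fin (k + 1)} {a : V j} {y : Σ i, V i}
    (h : T.Reachable ⟨j, a⟩ y) (hy : y.1 ≠ j) :
    ((blk T j).Reachable a (w j) ∧ Link v w T j) ∨
      ((blk T j).Reachable a (v j) ∧ Link v w T (j - 1)) := by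
  obtain ⟨p⟩ := h
  generalize hx : (⟨j, a⟩ : Σ i, V i) = x at p
  induction p generalizing a with
  | nil => exact absurd (congrArg Sigma.fst hx).symm hy
  | @cons x z y hadj p ih =>
    subst hx
    have hz : z ∈ T.neighborSet ⟨j, a⟩ := hadj
    rw [neighborSet_eq hT] at hz
    obtain (⟨b, hb, rfl⟩ | ⟨rfl, rfl, h⟩) | ⟨rfl, rfl, h⟩ := hz
    · have hr : (blk T j).Reachable a b := Adj.reachable hb
      exact (ih hy rfl).imp (fun h => ⟨hr.trans h.1, h.2⟩) (fun h => ⟨hr.trans h.1, h.2⟩)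
    · exact Or.inl ⟨Reachable.refl _, h⟩
    · exact Or.inr ⟨Reachable.refl _, h⟩

variable [∀ i, Fintype (V i)]

theorem dg_eq (hk : 2 ≤ k) (hT : T ≤ cyclicJoin H v w) (j : Fin (k + 1)) (a : V j) :
    dg T ⟨j, a⟩ = dg (blk T j) a + ind (a = w j ∧ Link v w T j) +
      ind (a = v j ∧ Link v w T (j - 1)) := by
  have h1 := add_one_ne_self hk j
  have h2 := sub_one_ne_self hk j
  have h3 := add_one_ne_sub_one hk j
  unfold dg
  rw [neighborSet_eq hT, Set.ncard_union_eq, Set.ncard_union_eq,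
    Set.ncard_image_of_injective _ sigma_mk_injective, Nat.cast_add, Nat.cast_add,
    ncard_setOf_eq_and, ncard_setOf_eq_and]
  · rw [Set.disjoint_left]
    rintro _ ⟨b, -, rfl⟩ ⟨h, -⟩
    exact h1 (congrArg Sigma.fst h).symm
  · rw [Set.disjoint_left]
    rintro _ (⟨b, -, rfl⟩ | ⟨rfl, -⟩) ⟨h, -⟩
    · exact h2 (congrArg Sigma.fst h).symm
    · exact h3 (congrArg Sigma.fst h)

theorem exc_eq (hk : 2 ≤ k) (hT : T ≤ cyclicJoin H v w) (hm : ∀ ⦃a b⦄, T.Adj a b → a ∈ D)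
    (j : Fin (k + 1)) (a : V j) :
    exc T D ⟨j, a⟩ = exc (blk T j) (part D j) a + ind (a = w j ∧ Link v w T j) +
      ind (a = v j ∧ Link v w T (j - 1)) := by
  by_cases ha : (⟨j, a⟩ : Σ i, V i) ∈ D
  · rw [exc_mem _ ha, exc_mem _ (show a ∈ part D j from ha), dg_eq hk hT]
    ring
  · rw [exc_notMem _ ha, exc_notMem _ (show a ∉ part D j from ha), ind_not, ind_not]
    · rfl
    · rintro ⟨rfl, h⟩
      exact ha (mem_of_link_sub_one hm h)
    · rintro ⟨rfl, h⟩
      exact ha (mem_of_link hm h)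

theorem sum_ind_eq_and {X : Type*} [Fintype X] (c : X) (p : Prop) :
    ∑ a, ind (a = c ∧ p) = ind p := by
  by_cases h : p
  · simp_rw [h, and_true]
    rw [sum_ind_eq, ind_of trivial]
  · simp [h, ind]

theorem sum_exc_block (hk : 2 ≤ k) (hT : T ≤ cyclicJoin H v w)
    (hm : ∀ ⦃a b⦄, T.Adj a b → a ∈ D) (j : Fin (k + 1)) :
    ∑ a, exc T D ⟨j, a⟩ =
      ∑ a, exc (blk T j) (part D j) a + ind (Link v w T j) + ind (Link v w T (j - 1)) := by
  simp_rw [exc_eq hk hT hm, Finset.sum_add_distrib, sum_ind_eq_and]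

/-- Removing the links leaves the excess sum of the block on its own, which is even by the handshake
lemma. -/
theorem even_sum_exc_block (hk : 2 ≤ k) (hT : T ≤ cyclicJoin H v w)
    (hm : ∀ ⦃a b⦄, T.Adj a b → a ∈ D) (j : Fin (k + 1)) :
    Even (∑ a, exc T D ⟨j, a⟩ - ind (Link v w T j) - ind (Link v w T (j - 1))) := by
  rw [sum_exc_block hk hT hm]
  have := even_sum_exc (T := blk T j) (D := part D j) fun a b h => hm h
  convert this using 1
  ring

theorem sum_exc_block_le (hk : 2 ≤ k) (hT : T ≤ cyclicJoin H v w)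
    (hm : ∀ ⦃a b⦄, T.Adj a b → a ∈ D) (hac : T.IsAcyclic) (j : Fin (k + 1))
    (hj : (part D j).Nonempty) :
    ∑ a, exc T D ⟨j, a⟩ ≤ ind (Link v w T j) + ind (Link v w T (j - 1)) - 2 := by
  rw [sum_exc_block hk hT hm]
  have := sum_exc_le (T := blk T j) (D := part D j) hj (fun a b h => hm h)
    (hac.comap ⟨Sigma.mk j, fun h => h⟩ sigma_mk_injective)
  omega

/-- A block in which every vertex has degree 2 is traversed by a hamiltonian path from its entry
to its exit. -/
theorem traversed_block (hk : 2 ≤ k) (hT : T ≤ cyclicJoin H v w) (hD : Spans T D) {j : Fin (k + 1)}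
    {y : Σ i, V i} (hy : y ∈ D) (hyj : y.1 ≠ j) (hj : (part D j).Nonempty)
    (hd : ∀ a ∈ part D j, dg T ⟨j, a⟩ = 2) :
    Link v w T j ∧ Link v w T (j - 1) ∧ Spans (blk T j) (part D j) ∧
      ∀ a ∈ part D j, dg (blk T j) a + ind (a = v j) + ind (a = w j) = 2 := by
  have hex : ∀ a ∈ part D j, _ := fun a ha => reachable_exit hT (hD.reach ha hy) hyj
  have h0 : ∑ a, exc T D ⟨j, a⟩ = 0 := Finset.sum_eq_zero fun a _ => by
    by_cases ha : a ∈ part D j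
    · rw [exc_mem _ (show _ ∈ D from ha), hd a ha]
      rfl
    · exact exc_notMem _ ha
  have he := even_sum_exc_block hk hT hD.mem j
  rw [h0] at he
  -- The excess sum 0 forces an even number of links, and at least one is needed to reach `y`.
  have hl : Link v w T j ∧ Link v w T (j - 1) := by
    obtain ⟨a, ha⟩ := hj
    have h1 := hex a ha
    rcases ind_cases (Link v w T j) with h2 | h2 <;>
      rcases ind_cases (Link v w T (j - 1)) with h3 | h3
    · exact ⟨h2.1, h3.1⟩
    · rw [h2.2, h3.2] at he
      exact absurd he (by decide)
    · rw [h2.2, h3.2] at he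
      exact absurd he (by decide)
    · tauto
  have hd' : ∀ a ∈ part D j, dg (blk T j) a + ind (a = v j) + ind (a = w j) = 2 := by
    intro a ha
    have h1 := dg_eq hk hT j a
    simp only [hl.1, hl.2, and_true] at h1
    have := hd a ha
    omega
  refine ⟨hl.1, hl.2, ?_, hd'⟩
  refine spans_of_reachable_or (mem_of_link_sub_one hD.mem hl.2) (fun a b h => hD.mem h) hd' ?_
  intro a ha
  have := hex a ha
  tauto

/-- A block with a single leaf and no branch is covered by a hamiltonian path which starts at the
entry or exit of the block and ends at that leaf. -/
theorem terminal_block (hk : 2 ≤ k) (hT : T ≤ cyclicJoin H v w) (hD : Spans T D) {j : Fin (k + 1)}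
    {y : Σ i, V i} (hy : y ∈ D) (hyj : y.1 ≠ j) {t : V j} (ht : t ∈ part D j)
    (hd : ∀ a ∈ part D j, dg T ⟨j, a⟩ + ind (a = t) = 2) :
    (Link v w T j ∧ ¬ Link v w T (j - 1) ∧ Spans (blk T j) (part D j) ∧
      ∀ a ∈ part D j, dg (blk T j) a + ind (a = w j) + ind (a = t) = 2) ∨
    (Link v w T (j - 1) ∧ ¬ Link v w T j ∧ Spans (blk T j) (part D j) ∧
      ∀ a ∈ part D j, dg (blk T j) a + ind (a = v j) + ind (a = t) = 2) := by
  have hex : ∀ a ∈ part D j, _ := fun a ha => reachable_exit hT (hD.reach ha hy) hyj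
  have h0 : ∑ a, exc T D ⟨j, a⟩ = ∑ a, (- ind (a = t)) := Finset.sum_congr rfl fun a _ => by
    by_cases ha : a ∈ part D j
    · rw [exc_mem _ (show _ ∈ D from ha)]
      have := hd a ha
      omega
    · have hat : a ≠ t := fun h => ha (h ▸ ht)
      rw [exc_notMem _ (show (⟨j, a⟩ : Σ i, V i) ∉ D from ha), ind_not hat]
      rfl
  rw [Finset.sum_neg_distrib, sum_ind_eq] at h0
  have he := even_sum_exc_block hk hT hD.mem j
  rw [h0] at he
  -- The excess sum is −1, so exactly one of the two links is present.
  rcases ind_cases (Link v w T j) with h2 | h2 <;>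
    rcases ind_cases (Link v w T (j - 1)) with h3 | h3
  · rw [h2.2, h3.2] at he
    exact absurd he (by decide)
  · have hd' : ∀ a ∈ part D j, dg (blk T j) a + ind (a = w j) + ind (a = t) = 2 := by
      intro a ha
      have h1 := dg_eq hk hT j a
      simp only [h2.1, h3.1, and_true, and_false, ind_not not_false] at h1
      have := hd a ha
      omega
    refine Or.inl ⟨h2.1, h3.1, ?_, hd'⟩
    refine spans_of_reachable_or (mem_of_link hD.mem h2.1) (fun a b h => hD.mem h) hd' ?_
    intro a ha
    have := hex a ha
    tauto
  · have hd' : ∀ a ∈ part D j, dg (blk T j) a + ind (a = v j) + ind (a = t) = 2 := by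
      intro a ha
      have h1 := dg_eq hk hT j a
      simp only [h2.1, h3.1, and_true, and_false, ind_not not_false] at h1
      have := hd a ha
      omega
    refine Or.inr ⟨h3.1, h2.1, ?_, hd'⟩
    refine spans_of_reachable_or (mem_of_link_sub_one hD.mem h3.1) (fun a b h => hD.mem h) hd' ?_
    intro a ha
    have := hex a ha
    tauto
  · rw [h2.2, h3.2] at he
    exact absurd he (by decide)

end Blocks

/-! ### Small indices on the cycle -/

section Indices

variable {k : ℕ}

theorem one_ne_zero_fin (hk : 2 ≤ k) : (1 : Fin (k + 1)) ≠ 0 := by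
  have := add_one_ne_self hk 0
  rwa [zero_add] at this

theorem one_add_one_ne_zero_fin (hk : 2 ≤ k) : (1 : Fin (k + 1)) + 1 ≠ 0 := by
  intro h
  refine add_one_ne_sub_one hk 0 ?_
  rw [zero_add, zero_sub]
  exact eq_neg_of_add_eq_zero_left h

theorem one_add_one_add_one_ne_zero_fin (hk : 3 ≤ k) : (1 : Fin (k + 1)) + 1 + 1 ≠ 0 := by
  intro h
  have := congrArg Fin.val h
  rw [Fin.val_add, Fin.val_add, Fin.val_one', Nat.mod_eq_of_lt (a := 1) (by omega),
    Nat.mod_eq_of_lt (a := 1 + 1) (by omega), Nat.mod_eq_of_lt (by omega)] at this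
  simp at this

end Indices

/-! ### Shape of spanning trees and non-hamiltonicity -/

section Trees

variable {k : ℕ} {V : Fin (k + 1) → Type*} {H : ∀ i, SimpleGraph (V i)} {v w : ∀ i, V i}
  {T : SimpleGraph (Σ i, V i)} {D : Set (Σ i, V i)}

theorem part_compl_of_ne {u : Σ i, V i} {j : Fin (k + 1)} (h : j ≠ u.1) :
    part ({u}ᶜ : Set (Σ i, V i)) j = Set.univ := by
  ext a
  simp only [Set.mem_preimage, Set.mem_compl_iff, Set.mem_singleton_iff, Set.mem_univ, iff_true]
  rintro rfl
  exact h rfl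

theorem part_compl_mk {j : Fin (k + 1)} (a : V j) :
    part ({⟨j, a⟩}ᶜ : Set (Σ i, V i)) j = {a}ᶜ := by
  ext b
  simp

theorem part_compl_nonempty (hne : ∀ j, v j ≠ w j) (u : Σ i, V i) (j : Fin (k + 1)) :
    (part ({u}ᶜ : Set (Σ i, V i)) j).Nonempty := by
  by_cases h : j = u.1
  · obtain ⟨i, a⟩ := u
    subst h
    rw [part_compl_mk]
    by_cases ha : v j = a
    · exact ⟨w j, fun h => hne j (ha.trans h.symm)⟩
    · exact ⟨v j, ha⟩
  · rw [part_compl_of_ne h]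
    exact ⟨v j, trivial⟩

variable [∀ i, Fintype (V i)]

theorem dg_pos_of_spans {X : Type*} [Finite X] {T : SimpleGraph X} {D : Set X} (hD : Spans T D)
    {a b : X} (ha : a ∈ D) (hb : b ∈ D) (hab : a ≠ b) : 0 < dg T a := by
  obtain ⟨p⟩ := hD.reach ha hb
  cases p with
  | nil => exact absurd rfl hab
  | cons h _ => exact dg_pos_of_adj h

theorem exists_dg_lt_two {j : Fin (k + 1)} (h : ∑ a, exc T D ⟨j, a⟩ < 0) :
    ∃ a ∈ part D j, dg T ⟨j, a⟩ < 2 := by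
  by_contra! hc
  refine absurd h (not_lt.2 (Finset.sum_nonneg fun a _ => ?_))
  by_cases ha : a ∈ part D j
  · rw [exc_mem _ (show (⟨j, a⟩ : Σ i, V i) ∈ D from ha)]
    have := hc a ha
    omega
  · rw [exc_notMem _ (show (⟨j, a⟩ : Σ i, V i) ∉ D from ha)]

theorem exists_two_lt_dg {j : Fin (k + 1)} (h : 0 ≤ ∑ a, exc T D ⟨j, a⟩) {t : V j}
    (ht : t ∈ part D j) (hd : dg T ⟨j, t⟩ < 2) : ∃ a ∈ part D j, 2 < dg T ⟨j, a⟩ := by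
  by_contra! hc
  refine absurd h (not_le.2 ?_)
  refine Finset.sum_neg' (fun a _ => ?_) ⟨t, Finset.mem_univ t, ?_⟩
  · by_cases ha : a ∈ part D j
    · rw [exc_mem _ (show (⟨j, a⟩ : Σ i, V i) ∈ D from ha)]
      have := hc a ha
      omega
    · rw [exc_notMem _ (show (⟨j, a⟩ : Σ i, V i) ∉ D from ha)]
  · rw [exc_mem _ (show (⟨j, t⟩ : Σ i, V i) ∈ D from ht)]
    omega

/-- If the excesses in a block sum to `-1`, then either some vertex other than `t` is a leaf, or
`t` is the only vertex of the block whose degree is not 2. -/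
theorem exists_other_leaf_or {j : Fin (k + 1)} (h : ∑ a, exc T D ⟨j, a⟩ = -1) {t : V j}
    (hpos : ∀ z ∈ D, 0 < dg T z) :
    (∃ a ∈ part D j, a ≠ t ∧ dg T ⟨j, a⟩ < 2) ∨
      ∀ a ∈ part D j, dg T ⟨j, a⟩ + ind (a = t) = 2 := by
  by_contra! hc
  obtain ⟨hc, a, ha, hne⟩ := hc
  have h0 : ∀ a ∈ Finset.univ, 0 ≤ exc T D ⟨j, a⟩ + ind (a = t) := fun a _ => by
    by_cases ha : a ∈ part D j
    · rw [exc_mem _ (show (⟨j, a⟩ : Σ i, V i) ∈ D from ha)]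
      have h1 := hpos _ ha
      rcases ind_cases (a = t) with h2 | h2
      · omega
      · have := hc a ha h2.1
        omega
    · rw [exc_notMem _ (show (⟨j, a⟩ : Σ i, V i) ∉ D from ha)]
      have := ind_nonneg (a = t)
      omega
  have hs : ∑ a, (exc T D ⟨j, a⟩ + ind (a = t)) = 0 := by
    rw [Finset.sum_add_distrib, h, sum_ind_eq]
    rfl
  have := (Finset.sum_eq_zero_iff_of_nonneg h0).1 hs a (Finset.mem_univ a)
  rw [exc_mem _ (show (⟨j, a⟩ : Σ i, V i) ∈ D from ha)] at this
  omega

/-- A spanning tree which omits one of the connecting edges contains all the others, and its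
degree sums over the blocks are determined. -/
theorem sum_exc_block_of_not_link (hk : 2 ≤ k) (hT : T ≤ cyclicJoin H v w) (hD : Spans T D)
    (hac : T.IsAcyclic) (hs : ∑ z, exc T D z = -2) (hne : ∀ j, (part D j).Nonempty)
    {m : Fin (k + 1)} (hm : ¬ Link v w T m) :
    (∀ j, j ≠ m → Link v w T j) ∧
      ∀ j, ∑ a, exc T D ⟨j, a⟩ = ind (Link v w T j) + ind (Link v w T (j - 1)) - 2 := by
  rw [Fintype.sum_sigma] at hs
  have h1 : ∀ j ∈ Finset.univ, 0 ≤ ind (Link v w T j) + ind (Link v w T (j - 1)) - 2 -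
      ∑ a, exc T D ⟨j, a⟩ := fun j _ => by
    have := sum_exc_block_le hk hT hD.mem hac j (hne j)
    omega
  have h2 : ∀ j ∈ Finset.univ, 0 ≤ 1 - ind (Link v w T j) - ind (j = m) := fun j _ => by
    have := ind_le_one (Link v w T j)
    rcases ind_cases (j = m) with ⟨rfl, h⟩ | h
    · rw [h, ind_not hm]
      rfl
    · omega
  have h3 : ∑ j, ind (Link v w T (j - 1)) = ∑ j, ind (Link v w T j) :=
    Equiv.sum_comp (Equiv.subRight (1 : Fin (k + 1))) fun j => ind (Link v w T j)
  -- With L links present, the total slack is 2L − 2k in the block bounds and k − L in the bounds on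
  -- links. Neither is negative, so L = k and every bound is attained.
  have e1 : ∑ j, (ind (Link v w T j) + ind (Link v w T (j - 1)) - 2 - ∑ a, exc T D ⟨j, a⟩) =
      2 * ∑ j, ind (Link v w T j) - 2 * (k + 1) + 2 := by
    rw [Finset.sum_sub_distrib, Finset.sum_sub_distrib, Finset.sum_add_distrib, h3, hs]
    simp
    ring
  have e2 : ∑ j, (1 - ind (Link v w T j) - ind (j = m)) = k - ∑ j, ind (Link v w T j) := by
    rw [Finset.sum_sub_distrib, Finset.sum_sub_distrib, sum_ind_eq]
    simp
    ring
  have n1 := Finset.sum_nonneg h1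
  have n2 := Finset.sum_nonneg h2
  have z1 := (Finset.sum_eq_zero_iff_of_nonneg h1).1 (by omega)
  have z2 := (Finset.sum_eq_zero_iff_of_nonneg h2).1 (by omega)
  constructor
  · intro j hj
    have := z2 j (Finset.mem_univ j)
    rw [ind_not hj] at this
    rcases ind_cases (Link v w T j) with h | h
    · exact h.1
    · omega
  · intro j
    have := z1 j (Finset.mem_univ j)
    omega

theorem hasHamPath_of_spans_blk (hk : 2 ≤ k) (hT : T ≤ cyclicJoin H v w) {j : Fin (k + 1)}
    (hj : part D j = Set.univ) (hsp : Spans (blk T j) (part D j)) {a b : V j}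
    (hd : ∀ z ∈ part D j, dg (blk T j) z + ind (z = a) + ind (z = b) = 2) :
    HasHamPath (H j) a b := by
  rw [hj] at hsp hd
  exact hasHamPath_iff.2 ⟨blk T j, blk_le hk hT j, spans_univ_iff.1 hsp, fun z => hd z trivial⟩

/-- The obstruction that drives both bounds: a 2-regular intact block would be crossed by a
hamiltonian path from entry to exit. -/
theorem exists_dg_ne_two (hk : 2 ≤ k) (hT : T ≤ cyclicJoin H v w) (hD : Spans T D)
    {j : Fin (k + 1)} {y : Σ i, V i} (hy : y ∈ D) (hyj : y.1 ≠ j) (hj : part D j = Set.univ)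
    (hH : ¬ HasHamPath (H j) (v j) (w j)) : ∃ a, dg T ⟨j, a⟩ ≠ 2 := by
  by_contra! hc
  obtain ⟨-, -, h1, h2⟩ := traversed_block hk hT hD hy hyj (hj ▸ ⟨v j, trivial⟩) fun a _ => hc a
  exact hH (hasHamPath_of_spans_blk hk hT hj h1 h2)

theorem not_isHam_cyclicJoin (hk : 2 ≤ k) (hH : ¬ HasHamPath (H 0) (v 0) (w 0)) :
    ¬ IsHam (cyclicJoin H v w) := by
  rw [isHam_iff]
  rintro ⟨C, hC, hcon, hd⟩
  obtain ⟨a, ha⟩ := exists_dg_ne_two hk hC (spans_univ_iff.2 hcon) (j := 0) (y := ⟨1, v 1⟩) trivial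
    (one_ne_zero_fin hk) Set.preimage_univ hH
  exact ha (hd _)

theorem not_isHam_del_of_ne_zero (hk : 2 ≤ k) (hne : ∀ j, v j ≠ w j)
    (hH : ¬ HasHamPath (H 0) (v 0) (w 0)) {u : Σ i, V i} (hu : u.1 ≠ 0) :
    ¬ IsHam (del (cyclicJoin H v w) u) := by
  rw [isHam_del_iff]
  rintro ⟨C, hC, hcon, hd⟩
  obtain ⟨y, hy⟩ := part_compl_nonempty hne u 1
  obtain ⟨a, ha⟩ := exists_dg_ne_two hk hC hcon (j := 0) (y := ⟨1, y⟩) hy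
    (one_ne_zero_fin hk) (part_compl_of_ne hu.symm) hH
  refine ha (hd _ ?_)
  rintro rfl
  exact hu rfl

/-- A hamiltonian cycle would use both links of block `j`, but one of them vanished with `a`. -/
theorem not_isHam_del_of_eq (hk : 2 ≤ k) (hne : ∀ j, v j ≠ w j) {j : Fin (k + 1)} {a : V j}
    (ha : a = v j ∨ a = w j) : ¬ IsHam (del (cyclicJoin H v w) ⟨j, a⟩) := by
  rw [isHam_del_iff]
  rintro ⟨C, hC, hcon, hd⟩
  obtain ⟨y, hy⟩ := part_compl_nonempty hne ⟨j, a⟩ (j + 1)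
  obtain ⟨h1, h2, -, -⟩ := traversed_block hk hC hcon (j := j) (y := ⟨j + 1, y⟩) hy
    (add_one_ne_self hk j) (part_compl_nonempty hne _ j) fun b hb => hd _ hb
  rcases ha with rfl | rfl
  · exact mem_of_link_sub_one hcon.mem h2 rfl
  · exact mem_of_link hcon.mem h1 rfl

theorem dg_pos_of_spans_compl (hk : 2 ≤ k) (hne : ∀ j, v j ≠ w j) {u : Σ i, V i}
    (hD : Spans T {u}ᶜ) : ∀ z ∈ ({u}ᶜ : Set (Σ i, V i)), 0 < dg T z := by
  intro z hz
  obtain ⟨y, hy⟩ := part_compl_nonempty hne u (z.1 + 1)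
  refine dg_pos_of_spans hD hz hy ?_
  intro h
  exact add_one_ne_self hk z.1 (congrArg Sigma.fst h).symm

/-- The shape of a spanning tree of `G - u` when removing `u` destroys the edge between the blocks
`m` and `m + 1`, both of them different from block `0`. -/
theorem spanningTree_del_shape (hk : 2 ≤ k) (hne : ∀ j, v j ≠ w j)
    (hH : ¬ HasHamPath (H 0) (v 0) (w 0)) {m : Fin (k + 1)} (hm : m ≠ 0) (hm1 : m + 1 ≠ 0)
    {u : Σ i, V i} (hu : u = ⟨m, w m⟩ ∨ u = ⟨m + 1, v (m + 1)⟩) (hT : T ≤ cyclicJoin H v w)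
    (hD : Spans T {u}ᶜ) (hac : T.IsAcyclic) (hs : ∑ z, exc T {u}ᶜ z = -2) :
    ¬ Link v w T m ∧ (∃ a, 2 < dg T ⟨0, a⟩) ∧ (∃ a, dg T ⟨0, a⟩ < 2) ∧
    ∑ a, exc T {u}ᶜ ⟨m, a⟩ = -1 ∧ ∑ a, exc T {u}ᶜ ⟨m + 1, a⟩ = -1 := by
  have hnl : ¬ Link v w T m := by
    intro h
    rcases hu with rfl | rfl
    · exact hD.mem h rfl
    · exact hD.mem (Adj.symm h) rfl
  have hu0 : u.1 ≠ 0 := by rcases hu with rfl | rfl <;> assumption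
  obtain ⟨h1, h2⟩ :=
    sum_exc_block_of_not_link hk hT hD hac hs (part_compl_nonempty hne u) hnl
  have hp0 : part ({u}ᶜ : Set (Σ i, V i)) 0 = Set.univ := part_compl_of_ne hu0.symm
  have hmem : ∀ b : V 0, (⟨0, b⟩ : Σ i, V i) ∈ ({u}ᶜ : Set (Σ i, V i)) := by
    rintro b rfl
    exact hu0 rfl
  have hm0 : (0 : Fin (k + 1)) - 1 ≠ m := fun h => hm1 (by rw [← h, sub_add_cancel])
  have hs0 : ∑ a, exc T {u}ᶜ ⟨0, a⟩ = 0 := by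
    rw [h2 0, ind_of (h1 0 hm.symm), ind_of (h1 _ hm0)]
    rfl
  obtain ⟨y, hy⟩ := part_compl_nonempty hne u 1
  obtain ⟨a, ha⟩ := exists_dg_ne_two hk hT hD (j := 0) (y := ⟨1, y⟩) hy (one_ne_zero_fin hk) hp0 hH
  -- Block 0 keeps both links, so its excesses sum to 0. They are not all 0, so both signs occur: a
  -- leaf here and a branch below.
  have hbr : ∃ a, dg T ⟨0, a⟩ < 2 := by
    by_contra! hc
    have h0 : ∀ b ∈ Finset.univ, 0 ≤ exc T {u}ᶜ ⟨0, b⟩ := fun b _ => by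
      rw [exc_mem _ (hmem b)]
      have := hc b
      omega
    have := (Finset.sum_eq_zero_iff_of_nonneg h0).1 hs0 a (Finset.mem_univ a)
    rw [exc_mem _ (hmem a)] at this
    omega
  refine ⟨hnl, ?_, hbr, ?_, ?_⟩
  · obtain ⟨t, ht⟩ := hbr
    obtain ⟨b, -, hb⟩ := exists_two_lt_dg hs0.ge (hp0 ▸ trivial) ht
    exact ⟨b, hb⟩
  · rw [h2 m, ind_not hnl, ind_of (h1 _ (sub_one_ne_self hk m))]
    rfl
  · rw [h2 (m + 1), add_sub_cancel_right, ind_not hnl, ind_of (h1 _ (add_one_ne_self hk m))]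
    rfl

end Trees

/-! ### Lower bound: a deletion that changes three degrees -/

section LowerBound

variable {k : ℕ} {V : Fin (k + 1) → Type*} {H : ∀ i, SimpleGraph (V i)} {v w : ∀ i, V i}
  [∀ i, Fintype (V i)] {S : SimpleGraph (Σ i, V i)}

/-- Every spanning tree of `G - u` has at least three vertices whose degree is not their degree
in `S`. -/
def Costly (G S : SimpleGraph (Σ i, V i)) (u : Σ i, V i) : Prop :=
  ∀ T ≤ G, Spans T {u}ᶜ → T.IsAcyclic → ∑ z, exc T {u}ᶜ z = -2 →
    ∃ z₁ z₂ z₃, z₁ ≠ u ∧ z₂ ≠ u ∧ z₃ ≠ u ∧ z₁ ≠ z₂ ∧ z₁ ≠ z₃ ∧ z₂ ≠ z₃ ∧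
      dg S z₁ ≠ dg T z₁ ∧ dg S z₂ ≠ dg T z₂ ∧ dg S z₃ ≠ dg T z₃

/-- The three vertices are a branch in block 0, where `S` has degree at most 2, and a leaf in each
of the blocks `m` and `m + 1`, where `S` is 2-regular. -/
theorem costly_of_regular_blocks (hk : 2 ≤ k) (hne : ∀ j, v j ≠ w j)
    (hH : ¬ HasHamPath (H 0) (v 0) (w 0)) (hS : ∀ z, dg S z ≤ 2) {m : Fin (k + 1)} (hm : m ≠ 0)
    (hm1 : m + 1 ≠ 0) (h1 : ∀ a, dg S ⟨m, a⟩ = 2) (h2 : ∀ a, dg S ⟨m + 1, a⟩ = 2) :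
    Costly (cyclicJoin H v w) S ⟨m + 1, v (m + 1)⟩ := by
  intro T hT hD hac hs
  obtain ⟨-, ⟨b, hb⟩, -, h3, h4⟩ :=
    spanningTree_del_shape hk hne hH hm hm1 (Or.inr rfl) hT hD hac hs
  obtain ⟨a, ha, ha'⟩ := exists_dg_lt_two (h3.trans_lt (by decide))
  obtain ⟨c, hc, hc'⟩ := exists_dg_lt_two (h4.trans_lt (by decide))
  have := hS ⟨0, b⟩
  have := h1 a
  have := h2 c
  refine ⟨⟨0, b⟩, ⟨m, a⟩, ⟨m + 1, c⟩, fun h => hm1 (congrArg Sigma.fst h).symm, ha, hc,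
    fun h => hm (congrArg Sigma.fst h).symm, fun h => hm1 (congrArg Sigma.fst h).symm,
    fun h => add_one_ne_self hk m (congrArg Sigma.fst h).symm, ?_, ?_, ?_⟩ <;> omega

/-- Here `S` is a hamiltonian path with ends `l` in block 0 and `t`. If `t` is not in block 0, then
`S` omits one link of block 0 and `t` lies in the block across it. For `k ≥ 3` some link avoids
block 0 and the block of `t`; for `k = 2` one deletes the end of the middle link that is not in the
block of `t`. -/
theorem exists_costly (hk : 2 ≤ k) (hne : ∀ j, v j ≠ w j)
    (hH : ¬ HasHamPath (H 0) (v 0) (w 0))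
    (hk' : 3 ≤ k ∨ (k = 2 ∧ ∀ i, i ≠ 0 → ∀ y : V i,
      ¬ (HasHamPath (H i) (v i) y ∧ HasHamPath (H i) (w i) y)))
    (hSG : S ≤ cyclicJoin H v w) (hS : S.IsTree) {l t : Σ i, V i}
    (hprof : ∀ z, dg S z + ind (z = l) + ind (z = t) = 2) (hl : l.1 = 0) :
    ∃ u, u.1 ≠ 0 ∧ Costly (cyclicJoin H v w) S u := by
  have h10 := one_ne_zero_fin hk
  have h20 := one_add_one_ne_zero_fin hk
  have hle : ∀ z, dg S z ≤ 2 := fun z => by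
    have := hprof z
    have := ind_nonneg (z = l)
    have := ind_nonneg (z = t)
    omega
  have hreg : ∀ z, z.1 ≠ 0 → z ≠ t → dg S z = 2 := fun z hz hzt => by
    have hzl : z ≠ l := by rintro rfl; exact hz hl
    have := hprof z
    rw [ind_not hzl, ind_not hzt] at this
    omega
  have hfst : ∀ {z : Σ i, V i}, dg S z < 2 → z.1 ≠ 0 → z = t := fun hz hz0 => by
    by_contra hzt
    exact absurd (hreg _ hz0 hzt) hz.ne
  have hgood : ∀ m : Fin (k + 1), m ≠ 0 → m + 1 ≠ 0 → t.1 ≠ m → t.1 ≠ m + 1 →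
      ∃ u, u.1 ≠ 0 ∧ Costly (cyclicJoin H v w) S u := fun m hm hm1 ht ht1 =>
    ⟨⟨m + 1, v (m + 1)⟩, hm1, costly_of_regular_blocks hk hne hH hle hm hm1
      (fun a => hreg _ hm fun h => ht (congrArg Sigma.fst h).symm)
      (fun a => hreg _ hm1 fun h => ht1 (congrArg Sigma.fst h).symm)⟩
  by_cases ht0 : t.1 = 0
  · exact hgood 1 h10 h20 (by rw [ht0]; exact h10.symm) (by rw [ht0]; exact h20.symm)
  have hSp : Spans S Set.univ := spans_univ_iff.2 hS.1
  have hpu : ∀ j, part (Set.univ : Set (Σ i, V i)) j = Set.univ := fun j => Set.preimage_univ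
  have hpn : ∀ j, (part (Set.univ : Set (Σ i, V i)) j).Nonempty := fun j => ⟨v j, trivial⟩
  have hterm0 : (Link v w S 0 ∧ ¬ Link v w S (0 - 1)) ∨ (Link v w S (0 - 1) ∧ ¬ Link v w S 0) := by
    obtain ⟨i, l⟩ := l
    obtain rfl : i = 0 := hl
    have := terminal_block hk hSG hSp (j := 0) (t := l) (y := ⟨1, v 1⟩) trivial h10 trivial
      fun a _ => by
        have := hprof ⟨0, a⟩
        have hat : (⟨0, a⟩ : Σ i, V i) ≠ t := by rintro rfl; exact ht0 rfl
        rw [ind_not hat] at this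
        simpa using this
    tauto
  -- a block of `S` missing one of its two connecting edges contains the second leaf
  have hend : ∀ j : Fin (k + 1), j ≠ 0 → (¬ Link v w S j ∨ ¬ Link v w S (j - 1)) → t.1 = j := by
    intro j hj hmiss
    have h1 := sum_exc_block_le hk hSG hSp.mem hS.2 j (hpn j)
    have h2 : ∑ a, exc S Set.univ ⟨j, a⟩ < 0 := by
      have := ind_le_one (Link v w S j)
      have := ind_le_one (Link v w S (j - 1))
      rcases hmiss with h | h <;> rw [ind_not h] at h1 <;> omega
    obtain ⟨a, -, ha⟩ := exists_dg_lt_two h2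
    rw [← hfst ha hj]
  -- for `k = 2`: two hamiltonian paths of the block with the second leaf lead to a contradiction
  have hpath : ∀ {T : SimpleGraph (Σ i, V i)} {D : Set (Σ i, V i)} {j : Fin (k + 1)} {t' : V j},
      j ≠ 0 → T ≤ cyclicJoin H v w → Spans T D → (∃ y ∈ D, y.1 ≠ j) → part D j = Set.univ →
      (∀ a ∈ part D j, dg T ⟨j, a⟩ + ind (a = t') = 2) →
      (¬ Link v w T (j - 1) → HasHamPath (H j) (w j) t') ∧
      (¬ Link v w T j → HasHamPath (H j) (v j) t') := by
    rintro T D j t' hj hT hD ⟨y, hy, hyj⟩ hp hd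
    rcases terminal_block hk hT hD hy hyj (hp ▸ trivial) hd with h | h
    · exact ⟨fun _ => hasHamPath_of_spans_blk hk hT hp h.2.2.1 h.2.2.2, fun h' => absurd h.1 h'⟩
    · exact ⟨fun h' => absurd h.1 h', fun _ => hasHamPath_of_spans_blk hk hT hp h.2.2.1 h.2.2.2⟩
  have hSd : ∀ {j : Fin (k + 1)} {t' : V j}, j ≠ 0 → t = ⟨j, t'⟩ →
      ∀ a ∈ part (Set.univ : Set (Σ i, V i)) j, dg S ⟨j, a⟩ + ind (a = t') = 2 := by
    rintro j t' hj rfl a -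
    have hal : (⟨j, a⟩ : Σ i, V i) ≠ l := by rintro rfl; exact hj hl
    have := hprof ⟨j, a⟩
    rw [ind_not hal] at this
    simpa using this
  -- Of the blocks `m` and `m + 1`, `e` contains `t` and `o` contains `u`. The deletion is costly
  -- once block `e` is forced to contain a vertex of degree below 2 other than `t`.
  have hcost : ∀ {u : Σ i, V i} {m e o : Fin (k + 1)} {t' : V e}, m ≠ 0 → m + 1 ≠ 0 →
      (u = ⟨m, w m⟩ ∨ u = ⟨m + 1, v (m + 1)⟩) → ((e = m ∧ o = m + 1) ∨ (e = m + 1 ∧ o = m)) →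
      e ≠ u.1 → t = ⟨e, t'⟩ →
      (∀ T ≤ cyclicJoin H v w, Spans T {u}ᶜ → ¬ Link v w T m →
        ¬ ∀ a ∈ part ({u}ᶜ : Set (Σ i, V i)) e, dg T ⟨e, a⟩ + ind (a = t') = 2) →
      Costly (cyclicJoin H v w) S u := by
    intro u m e o t' hm hm1 hu heo heu ht hno T hT hD hac hs
    obtain ⟨hlk, ⟨b, hb⟩, -, h3, h4⟩ := spanningTree_del_shape hk hne hH hm hm1 hu hT hD hac hs
    have hu0 : u.1 ≠ 0 := by rcases hu with rfl | rfl <;> assumption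
    have hmm := add_one_ne_self hk m
    obtain ⟨h5, h6, he0, ho0, heo'⟩ : ∑ a, exc T {u}ᶜ ⟨e, a⟩ = -1 ∧ ∑ a, exc T {u}ᶜ ⟨o, a⟩ = -1 ∧
        e ≠ 0 ∧ o ≠ 0 ∧ e ≠ o := by
      rcases heo with ⟨rfl, rfl⟩ | ⟨rfl, rfl⟩
      · exact ⟨h3, h4, hm, hm1, hmm.symm⟩
      · exact ⟨h4, h3, hm1, hm, hmm⟩
    obtain ⟨c, hc, hc'⟩ := exists_dg_lt_two (h6.trans_lt (by decide))
    rcases exists_other_leaf_or h5 (t := t') (dg_pos_of_spans_compl hk hne hD) with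
      ⟨a, ha, hat, ha'⟩ | hall
    · have := hle ⟨0, b⟩
      have := hreg ⟨e, a⟩ he0 (by rw [ht]; simpa using hat)
      have := hreg ⟨o, c⟩ ho0 (by rw [ht]; exact fun h => heo' (congrArg Sigma.fst h).symm)
      refine ⟨⟨0, b⟩, ⟨e, a⟩, ⟨o, c⟩, ?_, ha, hc, fun h => he0 (congrArg Sigma.fst h).symm,
        fun h => ho0 (congrArg Sigma.fst h).symm, fun h => heo' (congrArg Sigma.fst h), ?_, ?_, ?_⟩
      · rintro rfl
        exact hu0 rfl
      all_goals omega
    · exact absurd hall (hno T hT hD hlk)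
  rcases hterm0 with ⟨-, hlast⟩ | ⟨-, hfirst⟩
  · -- the second leaf lies in the last block
    have htj : t.1 = 0 - 1 := hend (0 - 1) (sub_one_ne_self hk 0) (Or.inl hlast)
    have hn1 : t.1 ≠ 1 := by
      intro h
      exact h20 (sub_eq_iff_eq_add.1 (htj.symm.trans h)).symm
    rcases hk' with hk3 | ⟨hk2, hno⟩
    · refine hgood 1 h10 h20 hn1 fun h => one_add_one_add_one_ne_zero_fin hk3 ?_
      rw [← h, htj, sub_add_cancel]
    · have h3 : (0 : Fin (k + 1)) - 1 = 1 + 1 := by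
        subst hk2
        rfl
      obtain ⟨j, t'⟩ := t
      obtain rfl : j = 1 + 1 := htj.trans h3
      refine ⟨⟨1, w 1⟩, h10, hcost h10 h20 (Or.inl rfl) (Or.inr ⟨rfl, rfl⟩)
        (add_one_ne_self hk 1) rfl fun T hT hD hlk hall => hno _ h20 t' ⟨?_, ?_⟩⟩
      · exact (hpath h20 hSG hSp ⟨⟨0, v 0⟩, trivial, h20.symm⟩ (hpu _) (hSd h20 rfl)).2
          (h3 ▸ hlast)
      · refine (hpath h20 hT hD ⟨⟨0, v 0⟩, fun h => h10 (congrArg Sigma.fst h).symm, h20.symm⟩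
          (part_compl_of_ne (add_one_ne_self hk 1)) hall).1 ?_
        rwa [add_sub_cancel_right]
  -- The mirror case: the second leaf lies in block 1.
  · have htj : t.1 = 1 := hend 1 h10 (Or.inr (by rwa [sub_self]))
    rcases hk' with hk3 | ⟨hk2, hno⟩
    · refine hgood (1 + 1) h20 (one_add_one_add_one_ne_zero_fin hk3) ?_ ?_
      · rw [htj]
        exact (add_one_ne_self hk 1).symm
      · rw [htj, add_assoc]
        exact fun h => h20 (by simpa using h)
    · obtain ⟨j, t'⟩ := t
      obtain rfl : j = 1 := htj
      refine ⟨⟨1 + 1, v (1 + 1)⟩, h20, hcost h10 h20 (Or.inr rfl) (Or.inl ⟨rfl, rfl⟩)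
        (add_one_ne_self hk 1).symm rfl fun T hT hD hlk hall => hno _ h10 t' ⟨?_, ?_⟩⟩
      · exact (hpath h10 hT hD ⟨⟨0, v 0⟩, fun h => h20 (congrArg Sigma.fst h).symm, h10.symm⟩
          (part_compl_of_ne (add_one_ne_self hk 1).symm) hall).2 hlk
      · refine (hpath h10 hSG hSp ⟨⟨0, v 0⟩, trivial, h10.symm⟩ (hpu _) (hSd h10 rfl)).1 ?_
        rwa [sub_self]

end LowerBound

/-! ### Assembling spanning subgraphs from pieces of the blocks -/

section Glue

variable {k : ℕ} {V : Fin (k + 1) → Type*}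

/-- The disjoint union of graphs on the blocks together with the connecting edges with index in
`J`. -/
def glue (v w : ∀ i, V i) (R : ∀ i, SimpleGraph (V i)) (J : Set (Fin (k + 1))) :
    SimpleGraph (Σ i, V i) :=
  SimpleGraph.fromRel fun p q =>
    (∃ (i : Fin (k + 1)) (a b : V i), (R i).Adj a b ∧ p = ⟨i, a⟩ ∧ q = ⟨i, b⟩) ∨
    (∃ i ∈ J, p = ⟨i, w i⟩ ∧ q = ⟨i + 1, v (i + 1)⟩)

variable {H R : ∀ i, SimpleGraph (V i)} {v w : ∀ i, V i} {J : Set (Fin (k + 1))}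
  {D : Set (Σ i, V i)}

theorem glue_adj_of_adj {j : Fin (k + 1)} {a b : V j} (h : (R j).Adj a b) :
    (glue v w R J).Adj ⟨j, a⟩ ⟨j, b⟩ := by
  refine ⟨fun h' => h.ne ?_, Or.inl (Or.inl ⟨j, a, b, h, rfl, rfl⟩)⟩
  simpa using h'

theorem glue_adj_cases {p q : Σ i, V i} (h : (glue v w R J).Adj p q) :
    (∃ j a b, (R j).Adj a b ∧ p = ⟨j, a⟩ ∧ q = ⟨j, b⟩) ∨
    (∃ j ∈ J, p = ⟨j, w j⟩ ∧ q = ⟨j + 1, v (j + 1)⟩) ∨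
    (∃ j ∈ J, q = ⟨j, w j⟩ ∧ p = ⟨j + 1, v (j + 1)⟩) := by
  obtain ⟨-, (h | h) | (⟨j, a, b, h, h1, h2⟩ | h)⟩ := h
  · exact Or.inl h
  · exact Or.inr (Or.inl h)
  · exact Or.inl ⟨j, b, a, h.symm, h2, h1⟩
  · exact Or.inr (Or.inr h)

theorem glue_le_cyclicJoin (hR : ∀ j, R j ≤ H j) : glue v w R J ≤ cyclicJoin H v w := by
  rintro p q ⟨hne, h⟩
  refine ⟨hne, h.imp (Or.imp ?_ ?_) (Or.imp ?_ ?_)⟩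
  · exact fun ⟨i, a, b, h, h'⟩ => ⟨i, a, b, hR i h, h'⟩
  · exact fun ⟨i, _, h'⟩ => ⟨i, h'⟩
  · exact fun ⟨i, a, b, h, h'⟩ => ⟨i, a, b, hR i h, h'⟩
  · exact fun ⟨i, _, h'⟩ => ⟨i, h'⟩

theorem blk_glue (hk : 2 ≤ k) (j : Fin (k + 1)) : blk (glue v w R J) j = R j := by
  ext a b
  refine ⟨fun h => ?_, glue_adj_of_adj⟩
  rcases glue_adj_cases h with ⟨i, a', b', h, h1, h2⟩ | ⟨i, -, h1, h2⟩ | ⟨i, -, h1, h2⟩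
  · cases h1
    cases h2
    exact h
  · have e1 : j = i := congrArg Sigma.fst h1
    have e2 : j = i + 1 := congrArg Sigma.fst h2
    exact absurd (e2.symm.trans e1) (add_one_ne_self hk i)
  · have e1 : j = i := congrArg Sigma.fst h1
    have e2 : j = i + 1 := congrArg Sigma.fst h2
    exact absurd (e2.symm.trans e1) (add_one_ne_self hk i)

theorem link_glue (hk : 2 ≤ k) (j : Fin (k + 1)) : Link v w (glue v w R J) j ↔ j ∈ J := by
  constructor
  · intro h
    rcases glue_adj_cases h with ⟨i, a', b', h, h1, h2⟩ | ⟨i, hi, h1, h2⟩ | ⟨i, -, h1, h2⟩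
    · have e1 : j = i := congrArg Sigma.fst h1
      have e2 : j + 1 = i := congrArg Sigma.fst h2
      exact absurd (e2.trans e1.symm) (add_one_ne_self hk j)
    · have e1 : j = i := congrArg Sigma.fst h1
      exact e1 ▸ hi
    · have e1 : j + 1 = i := congrArg Sigma.fst h1
      have e2 : j = i + 1 := congrArg Sigma.fst h2
      exact absurd (e1.trans (eq_sub_of_add_eq e2.symm)) (add_one_ne_sub_one hk j)
  · exact fun h =>
      ⟨fun h' => add_one_ne_self hk j (congrArg Sigma.fst h').symm, Or.inl (Or.inr ⟨j, h, rfl, rfl⟩)⟩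

theorem dg_glue [∀ i, Fintype (V i)] (hk : 2 ≤ k) (j : Fin (k + 1)) (a : V j) :
    dg (glue v w R J) ⟨j, a⟩ =
      dg (R j) a + ind (a = w j ∧ j ∈ J) + ind (a = v j ∧ j - 1 ∈ J) := by
  rw [dg_eq (H := R) hk (glue_le_cyclicJoin fun _ => le_rfl), blk_glue hk, link_glue hk,
    link_glue hk]

theorem glue_mem (hR : ∀ j, ∀ ⦃a b⦄, (R j).Adj a b → a ∈ part D j)
    (hJ : ∀ j ∈ J, w j ∈ part D j ∧ v (j + 1) ∈ part D (j + 1)) :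
    ∀ ⦃p q⦄, (glue v w R J).Adj p q → p ∈ D := by
  intro p q h
  rcases glue_adj_cases h with ⟨i, a, b, hab, rfl, -⟩ | ⟨i, hi, rfl, -⟩ | ⟨i, hi, -, rfl⟩
  · exact hR i hab
  · exact (hJ i hi).1
  · exact (hJ i hi).2

-- Induction once around the cycle, starting after `m`, so that the step from `m` to `m + 1` is
-- never needed.
open Fin.CommRing in
theorem cyclic_induction {P : Fin (k + 1) → Prop} (m : Fin (k + 1)) (h0 : P (m + 1))
    (h1 : ∀ j, j ≠ m → P j → P (j + 1)) (j : Fin (k + 1)) : P j := by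
  have h : ∀ n : ℕ, P (m + 1 + (n : Fin (k + 1))) := by
    intro n
    induction n with
    | zero => simpa using h0
    | succ n ih =>
      rw [Nat.cast_succ, ← add_assoc]
      by_cases hm : m + 1 + (n : Fin (k + 1)) = m
      · rwa [hm]
      · exact h1 _ hm ih
  have := h (j - (m + 1)).val
  rwa [Fin.cast_val_eq_self, add_sub_cancel] at this

theorem reachable_glue_of_reachable {j : Fin (k + 1)} {a b : V j} (h : (R j).Reachable a b) :
    (glue v w R J).Reachable ⟨j, a⟩ ⟨j, b⟩ :=
  h.map (⟨Sigma.mk j, glue_adj_of_adj⟩ : R j →g glue v w R J)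

theorem spans_glue_of_all_but_one (hk : 2 ≤ k) (hR : ∀ j, Spans (R j) (part D j))
    (m : Fin (k + 1)) (hm : ∀ j, j ≠ m → j ∈ J)
    (hJ : ∀ j ∈ J, w j ∈ part D j ∧ v (j + 1) ∈ part D (j + 1)) : Spans (glue v w R J) D := by
  obtain ⟨c, hc⟩ := (hR (m + 1)).nonempty
  have key : ∀ j, ∀ a ∈ part D j, (glue v w R J).Reachable ⟨m + 1, c⟩ ⟨j, a⟩ := by
    refine cyclic_induction m ?_ ?_
    · intro a ha
      exact reachable_glue_of_reachable ((hR _).reach hc ha)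
    · intro j hj ih a ha
      have h1 := ih _ (hJ j (hm j hj)).1
      have h2 : (glue v w R J).Adj ⟨j, w j⟩ ⟨j + 1, v (j + 1)⟩ := (link_glue hk j).2 (hm j hj)
      exact h1.trans (h2.reachable.trans
        (reachable_glue_of_reachable ((hR _).reach (hJ j (hm j hj)).2 ha)))
  refine ⟨glue_mem (fun j => (hR j).mem) hJ, ⟨_, hc⟩, ?_⟩
  rintro ⟨i, a⟩ ha ⟨j, b⟩ hb
  exact (key i a ha).symm.trans (key j b hb)

/-- Blocks other than 0 form a connected chain; its two outer links pick up the parts of block 0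
attached to `v 0` and to `w 0`. -/
theorem spans_glue_of_two_parts (hk : 2 ≤ k) (hR : ∀ j, j ≠ 0 → Spans (R j) (part D j))
    (hR0 : ∀ ⦃a b⦄, (R 0).Adj a b → a ∈ part D 0)
    (h0 : ∀ a ∈ part D 0, (R 0).Reachable a (v 0) ∨ (R 0).Reachable a (w 0))
    (hJ : ∀ j, w j ∈ part D j ∧ v (j + 1) ∈ part D (j + 1)) :
    Spans (glue v w R Set.univ) D := by
  have hadj : ∀ j, (glue v w R Set.univ).Adj ⟨j, w j⟩ ⟨j + 1, v (j + 1)⟩ := fun j =>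
    (link_glue hk j).2 trivial
  have key : ∀ j, j ≠ 0 → ∀ a ∈ part D j,
      (glue v w R Set.univ).Reachable ⟨0 + 1, v (0 + 1)⟩ ⟨j, a⟩ := by
    refine cyclic_induction 0 ?_ ?_
    · intro h a ha
      exact reachable_glue_of_reachable ((hR _ h).reach (hJ 0).2 ha)
    · intro j hj ih hj1 a ha
      exact (ih hj _ (hJ j).1).trans ((hadj j).reachable.trans
        (reachable_glue_of_reachable ((hR _ hj1).reach (hJ j).2 ha)))
  have key' : ∀ z ∈ D, (glue v w R Set.univ).Reachable ⟨0 + 1, v (0 + 1)⟩ z := by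
    rintro ⟨j, a⟩ ha
    by_cases hj : j = 0
    · subst hj
      rcases h0 a ha with h | h
      · have h1 : (glue v w R Set.univ).Adj ⟨0 - 1, w (0 - 1)⟩ ⟨0, v 0⟩ :=
          link_sub_one.1 (hadj (0 - 1))
        exact (key _ (sub_one_ne_self hk 0) _ (hJ _).1).trans
          (h1.reachable.trans (reachable_glue_of_reachable h.symm))
      · exact (hadj 0).symm.reachable.trans (reachable_glue_of_reachable h.symm)
    · exact key j hj a ha
  refine ⟨glue_mem (fun j => ?_) fun j _ => hJ j, ⟨_, (hJ 0).1⟩, ?_⟩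
  · by_cases hj : j = 0
    · subst hj
      exact hR0
    · exact (hR j hj).mem
  · exact fun a ha b hb => (key' a ha).symm.trans (key' b hb)

end Glue

/-! ### Optimality and transition cost read off from degree profiles -/

section Cheap

variable {X : Type*} [Finite X] {G S T : SimpleGraph X} {u : X}

/-- Some ml-subgraph of `G - u` has transition cost at most 3 from `S`. -/
def Cheap (G S : SimpleGraph X) (u : X) : Prop :=
  ∃ Su ∈ mlSubgraphs (del G u), transitionCost S Su ≤ 3

theorem transitionCost_induce_le {z₁ z₂ z₃ : X} (hm : ∀ ⦃a b⦄, T.Adj a b → a ∈ ({u}ᶜ : Set X))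
    (h : ∀ z, z ≠ u → z ≠ z₁ → z ≠ z₂ → z ≠ z₃ → dg S z = dg T z) :
    transitionCost S (T.induce ({u}ᶜ : Set X)) ≤ 3 := by
  have h1 : Subtype.val '' {z : ({u}ᶜ : Set X) | deg S z ≠ deg (T.induce ({u}ᶜ : Set X)) z} ⊆
      {z₁, z₂, z₃} := by
    rintro _ ⟨z, hz, rfl⟩
    by_contra hc
    simp only [Set.mem_insert_iff, Set.mem_singleton_iff, not_or] at hc
    refine hz (deg_eq_deg_iff.2 ?_)
    rw [dg_induce hm]
    exact h z z.2 hc.1 hc.2.1 hc.2.2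
  have h2 := Set.encard_le_encard h1
  rw [Subtype.val_injective.encard_image] at h2
  refine h2.trans ((Set.encard_insert_le _ _).trans ?_)
  refine (add_le_add_left ((Set.encard_insert_le _ _).trans
    (add_le_add_left (Set.encard_singleton _).le 1)) 1).trans ?_
  norm_num

/-- The function `f` is the expected excess, extended by 0 at `u` so that it can be summed over all
of `X`. -/
theorem isSpanningTree_induce {f : X → ℤ} (hT : T ≤ G) (hD : Spans T {u}ᶜ)
    (hd : ∀ z ≠ u, dg T z - 2 = f z) (hfu : f u = 0) (hf : ∀ [Fintype X], ∑ z, f z = -2) :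
    IsSpanningTree (del G u) (T.induce ({u}ᶜ : Set X)) := by
  have := Fintype.ofFinite X
  refine ⟨comap_monotone _ hT, (isTree_induce_iff hD.mem).2 ⟨hD, ?_⟩⟩
  rw [← hf]
  refine Finset.sum_congr rfl fun z _ => ?_
  by_cases hz : z = u
  · subst hz
    rw [exc_notMem _ (by simp), hfu]
  · rw [exc_mem _ (by simpa using hz), hd z hz]

/-- Two hamiltonian paths differ in degree only at their ends; a shared end leaves at most the three
vertices `x`, `y`, `l₂`. -/
theorem cheap_of_profile_two (hG : ¬ IsHam (del G u)) (hnt : Nontrivial ({u}ᶜ : Set X))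
    (hT : T ≤ G) (hD : Spans T {u}ᶜ) {l₁ l₂ x y : X} (h1 : l₁ ≠ u) (h2 : l₂ ≠ u) (h12 : l₁ ≠ l₂)
    (hd : ∀ z ≠ u, dg T z + ind (z = l₁) + ind (z = l₂) = 2)
    (hS : ∀ z, dg S z + ind (z = x) + ind (z = y) = 2) (hl : l₁ = x ∨ l₁ = y) : Cheap G S u := by
  have htree : IsSpanningTree (del G u) (T.induce ({u}ᶜ : Set X)) := by
    refine isSpanningTree_induce (f := fun z => - ind (z = l₁) - ind (z = l₂)) hT hD
      (fun z hz => ?_) ?_ ?_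
    · have := hd z hz
      omega
    · rw [ind_not h1.symm, ind_not h2.symm]
      rfl
    · intro _
      rw [Finset.sum_sub_distrib, Finset.sum_neg_distrib, sum_ind_eq, sum_ind_eq]
      rfl
  refine ⟨T.induce ({u}ᶜ : Set X), mem_mlSubgraphs_of_minimal hG htree fun T' hT' => ?_, ?_⟩
  · rw [leafNumber_of_profile_two (l₁ := ⟨l₁, h1⟩) (l₂ := ⟨l₂, h2⟩)
      (fun h => h12 (congrArg Subtype.val h))]
    · exact two_le_leafNumber hT'.2
    · intro z
      rw [dg_induce hD.mem, Subtype.ext_iff, Subtype.ext_iff]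
      exact hd z z.2
  · refine transitionCost_induce_le (z₁ := x) (z₂ := y) (z₃ := l₂) hD.mem fun z hz hx hy h3 => ?_
    have e1 := hd z hz
    have e2 := hS z
    have hz1 : z ≠ l₁ := by rcases hl with rfl | rfl <;> assumption
    rw [ind_not hz1, ind_not h3] at e1
    rw [ind_not hx, ind_not hy] at e2
    omega

theorem cheap_of_profile_three (hG : ¬ IsHam (del G u))
    (hmin : ∀ T', IsSpanningTree (del G u) T' → 3 ≤ leafNumber T')
    (hT : T ≤ G) (hD : Spans T {u}ᶜ) {l₁ l₂ l₃ b z₁ z₂ z₃ : X} (h1 : l₁ ≠ u) (h2 : l₂ ≠ u)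
    (h3 : l₃ ≠ u) (hb : b ≠ u) (h12 : l₁ ≠ l₂) (h13 : l₁ ≠ l₃) (h23 : l₂ ≠ l₃) (h1b : l₁ ≠ b)
    (h2b : l₂ ≠ b) (h3b : l₃ ≠ b)
    (hd : ∀ z ≠ u, dg T z + ind (z = l₁) + ind (z = l₂) + ind (z = l₃) = 2 + ind (z = b))
    (hS : ∀ z, z ≠ u → z ≠ z₁ → z ≠ z₂ → z ≠ z₃ → dg S z = dg T z) : Cheap G S u := by
  have htree : IsSpanningTree (del G u) (T.induce ({u}ᶜ : Set X)) := by
    refine isSpanningTree_induce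
      (f := fun z => ind (z = b) - ind (z = l₁) - ind (z = l₂) - ind (z = l₃)) hT hD
      (fun z hz => ?_) ?_ ?_
    · have := hd z hz
      omega
    · rw [ind_not h1.symm, ind_not h2.symm, ind_not h3.symm, ind_not hb.symm]
      rfl
    · intro _
      rw [Finset.sum_sub_distrib, Finset.sum_sub_distrib, Finset.sum_sub_distrib, sum_ind_eq,
        sum_ind_eq, sum_ind_eq, sum_ind_eq]
      rfl
  refine ⟨T.induce ({u}ᶜ : Set X), mem_mlSubgraphs_of_minimal hG htree fun T' hT' => ?_,
    transitionCost_induce_le hD.mem hS⟩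
  rw [leafNumber_of_profile_three (l₁ := ⟨l₁, h1⟩) (l₂ := ⟨l₂, h2⟩) (l₃ := ⟨l₃, h3⟩) (b := ⟨b, hb⟩)
    (fun h => h12 (congrArg Subtype.val h)) (fun h => h13 (congrArg Subtype.val h))
    (fun h => h23 (congrArg Subtype.val h)) (fun h => h1b (congrArg Subtype.val h))
    (fun h => h2b (congrArg Subtype.val h)) (fun h => h3b (congrArg Subtype.val h))]
  · exact hmin T' hT'
  · intro z
    rw [dg_induce hD.mem, Subtype.ext_iff, Subtype.ext_iff, Subtype.ext_iff, Subtype.ext_iff]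
    exact hd z z.2

theorem cheap_of_hamCycle (hT : T ≤ G) (hD : Spans T {u}ᶜ) (hd : ∀ z ≠ u, dg T z = 2) {x y : X}
    (hS : ∀ z, dg S z + ind (z = x) + ind (z = y) = 2) : Cheap G S u := by
  refine ⟨T.induce ({u}ᶜ : Set X), IsHamCycle.mem_mlSubgraphs (isHamCycle_iff.2
    ⟨comap_monotone _ hT, (spans_iff_induce hD.mem).1 hD, fun z => ?_⟩), ?_⟩
  · rw [dg_induce hD.mem]
    exact hd z z.2
  · refine transitionCost_induce_le (z₁ := x) (z₂ := y) (z₃ := y) hD.mem fun z hz hx hy _ => ?_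
    have e2 := hS z
    rw [ind_not hx, ind_not hy] at e2
    rw [hd z hz]
    omega

end Cheap

/-! ### Path pieces inside a block -/

section Pieces

variable {W : Type*} {H : SimpleGraph W}

/-- The paths are disjoint, so each vertex keeps the degree it has in its own path. The reachability
clause is what `spans_glue_of_two_parts` needs for block 0. -/
theorem exists_two_paths {v w x y : W} {P : H.Walk v x} {Q : H.Walk w y} (hP : P.IsPath)
    (hQ : Q.IsPath) (hPQ : ∀ u : W, Xor (u ∈ P.support) (u ∈ Q.support)) :
    ∃ R ≤ H, (∀ a, R.Reachable a v ∨ R.Reachable a w) ∧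
      ∀ z, dg R z + ind (z = v) + ind (z = w) + ind (z = x) + ind (z = y) = 2 := by
  refine ⟨P.toSubgraph.spanningCoe ⊔ Q.toSubgraph.spanningCoe,
    sup_le P.toSubgraph.spanningCoe_le Q.toSubgraph.spanningCoe_le, fun a => ?_, fun z => ?_⟩
  · rcases hPQ a with ⟨h, -⟩ | ⟨h, -⟩
    · exact Or.inl ((spanningCoe_toSubgraph_reachable P h P.start_mem_support).mono le_sup_left)
    · exact Or.inr ((spanningCoe_toSubgraph_reachable Q h Q.start_mem_support).mono le_sup_right)
  · rcases hPQ z with ⟨h, h'⟩ | ⟨h, h'⟩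
    · have hn : (P.toSubgraph.spanningCoe ⊔ Q.toSubgraph.spanningCoe).neighborSet z =
          P.toSubgraph.spanningCoe.neighborSet z := by
        ext c
        refine ⟨fun hc => ?_, fun hc => Or.inl hc⟩
        rcases hc with hc | hc
        · exact hc
        · exact absurd (Walk.mem_support_of_adj_toSubgraph hc) h'
      have := dg_toSubgraph_of_isPath hP h
      have hw : z ≠ w := by rintro rfl; exact h' Q.start_mem_support
      have hy : z ≠ y := by rintro rfl; exact h' Q.end_mem_support
      rw [dg, hn, ind_not hw, ind_not hy]
      unfold dg at this
      omega
    · have hn : (P.toSubgraph.spanningCoe ⊔ Q.toSubgraph.spanningCoe).neighborSet z =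
          Q.toSubgraph.spanningCoe.neighborSet z := by
        ext c
        refine ⟨fun hc => ?_, fun hc => Or.inr hc⟩
        rcases hc with hc | hc
        · exact absurd (Walk.mem_support_of_adj_toSubgraph hc) h'
        · exact hc
      have := dg_toSubgraph_of_isPath hQ h
      have hv : z ≠ v := by rintro rfl; exact h' P.start_mem_support
      have hx : z ≠ x := by rintro rfl; exact h' P.end_mem_support
      rw [dg, hn, ind_not hv, ind_not hx]
      unfold dg at this
      omega

variable [Finite W]

/-- Deleting an endpoint of a hamiltonian path leaves a hamiltonian path. -/
theorem exists_path_del_endpoint {a b : W} (hab : a ≠ b) (h : HasHamPath H a b) :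
    ∃ n ≠ a, ∃ R ≤ H, Spans R {a}ᶜ ∧ ∀ z ≠ a, dg R z + ind (z = b) + ind (z = n) = 2 := by
  classical
  have := Fintype.ofFinite W
  obtain ⟨T, hTH, hT, hd⟩ := hasHamPath_iff.1 h
  have hda : dg T a = 1 := by
    have := hd a
    rw [ind_self, ind_not hab] at this
    omega
  have hcon : (T.induce ({a}ᶜ : Set W)).Connected := by
    refine hT.induce_compl_singleton_of_degree_eq_one ?_
    have := dg_eq_degree T a
    omega
  obtain ⟨n, hn⟩ : ∃ n, T.neighborSet a = {n} := Set.ncard_eq_one.1 (by unfold dg at hda; omega)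
  have han : T.Adj a n := by
    have : n ∈ T.neighborSet a := hn ▸ rfl
    exact this
  obtain ⟨R, hRT, hm, hR⟩ := exists_extension (G := T) (le_refl (T.induce ({a}ᶜ : Set W)))
  refine ⟨n, han.ne', R, hRT.trans hTH, (spans_iff_induce hm).2 (hR ▸ hcon), fun z hz => ?_⟩
  have hnb : R.neighborSet z = T.neighborSet z \ {a} := by
    ext c
    constructor
    · exact fun h => ⟨hRT h, hm (Adj.symm h)⟩
    · rintro ⟨h, hca⟩
      have : (R.induce ({a}ᶜ : Set W)).Adj ⟨z, hz⟩ ⟨c, hca⟩ := by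
        rw [hR]
        exact h
      exact this
  have hdz := hd z
  rw [ind_not hz] at hdz
  have hRz : dg R z + ind (z = n) = dg T z := by
    by_cases hzn : z = n
    · subst hzn
      have := Set.ncard_sdiff_singleton_add_one (s := T.neighborSet z) (a := a) han.symm
      rw [ind_self, dg, hnb, dg]
      omega
    · rw [ind_not hzn, dg, hnb, Set.sdiff_singleton_eq_self, dg, add_zero]
      intro h
      have : z ∈ T.neighborSet a := Adj.symm h
      rw [hn] at this
      exact hzn this
  omega

end Pieces

/-! ### Upper bound: deletions answered by a hamiltonian cycle or by cutting the ring next to block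
0 -/

section Upper

theorem ind_and_of {p q : Prop} (h : q) : ind (p ∧ q) = ind p := by simp [h]

theorem ind_and_not {p q : Prop} (h : ¬ q) : ind (p ∧ q) = 0 := by simp [h, ind]

/-- `R` is a hamiltonian path of `H[D]` with endpoints `p` and `q`. -/
structure PathOn {W : Type*} (H R : SimpleGraph W) (D : Set W) (p q : W) : Prop where
  le : R ≤ H
  spans : Spans R D
  dg_add : ∀ z ∈ D, dg R z + ind (z = p) + ind (z = q) = 2

theorem exists_pathOn_univ {W : Type*} [Finite W] {H : SimpleGraph W} {p q : W}
    (h : HasHamPath H p q) : ∃ R, PathOn H R Set.univ p q := by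
  obtain ⟨R, h1, h2, h3⟩ := hasHamPath_iff.1 h
  exact ⟨R, h1, spans_univ_iff.2 h2, fun z _ => h3 z⟩

theorem exists_pathOn_compl {W : Type*} [Finite W] {H : SimpleGraph W} {u p q : W}
    {hp : p ∈ ({u}ᶜ : Set W)} {hq : q ∈ ({u}ᶜ : Set W)}
    (h : HasHamPath (del H u) ⟨p, hp⟩ ⟨q, hq⟩) : ∃ R, PathOn H R {u}ᶜ p q := by
  obtain ⟨R, h1, h2, h3⟩ := hasHamPath_del_iff.1 h
  exact ⟨R, h1, h2, fun z hz => h3 z hz⟩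

variable {k : ℕ} {V : Fin (k + 1) → Type*} {H : ∀ i, SimpleGraph (V i)} {v w : ∀ i, V i}

theorem sigma_ne_of_fst_ne {i j : Fin (k + 1)} (h : i ≠ j) (a : V i) (b : V j) :
    (⟨i, a⟩ : Σ i, V i) ≠ ⟨j, b⟩ := fun h' => h (congrArg Sigma.fst h')

theorem sigma_ne_of_snd_ne {i : Fin (k + 1)} {a b : V i} (h : a ≠ b) :
    (⟨i, a⟩ : Σ i, V i) ≠ ⟨i, b⟩ := fun h' => h (sigma_mk_injective h')

theorem ind_sigma {i : Fin (k + 1)} (a b : V i) : ind ((⟨i, a⟩ : Σ i, V i) = ⟨i, b⟩) = ind (a = b) := by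
  simp

theorem ind_sigma_ne {i j : Fin (k + 1)} (h : i ≠ j) (a : V i) (b : V j) :
    ind ((⟨i, a⟩ : Σ i, V i) = ⟨j, b⟩) = 0 := ind_not (sigma_ne_of_fst_ne h a b)

theorem spans_part_of_ne {j : Fin (k + 1)} {u : Σ i, V i} (h : j ≠ u.1) {R : SimpleGraph (V j)}
    (hR : Spans R Set.univ) : Spans R (part ({u}ᶜ : Set (Σ i, V i)) j) := by
  rwa [part_compl_of_ne h]

theorem spans_part_mk {j : Fin (k + 1)} {c : V j} {R : SimpleGraph (V j)}
    (hR : Spans R {c}ᶜ) : Spans R (part ({⟨j, c⟩}ᶜ : Set (Σ i, V i)) j) := by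
  rwa [part_compl_mk]

theorem nontrivial_compl (hk : 2 ≤ k) (hne : ∀ j, v j ≠ w j) (u : Σ i, V i) :
    Nontrivial ({u}ᶜ : Set (Σ i, V i)) := by
  have h := add_one_ne_self hk u.1
  refine ⟨⟨⟨u.1 + 1, v _⟩, fun h' => h (congrArg Sigma.fst h')⟩,
    ⟨⟨u.1 + 1, w _⟩, fun h' => h (congrArg Sigma.fst h')⟩, fun h' => ?_⟩
  exact sigma_ne_of_snd_ne (hne _) (congrArg Subtype.val h')

variable [∀ i, Fintype (V i)] {S : SimpleGraph (Σ i, V i)} {x y : V 0}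

theorem exists_family_zero (hP : ∀ j, j ≠ 0 → HasHamPath (H j) (v j) (w j))
    {R0 : SimpleGraph (V 0)} (h0 : R0 ≤ H 0) :
    ∃ R : ∀ j, SimpleGraph (V j), R 0 = R0 ∧ (∀ j, R j ≤ H j) ∧
      ∀ j, j ≠ 0 → PathOn (H j) (R j) Set.univ (v j) (w j) := by
  have : ∀ j, ∃ R : SimpleGraph (V j), j ≠ 0 → PathOn (H j) R Set.univ (v j) (w j) := fun j => by
    by_cases hj : j = 0
    · exact ⟨⊥, fun h => absurd hj h⟩
    · obtain ⟨R, hR⟩ := exists_pathOn_univ (hP j hj)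
      exact ⟨R, fun _ => hR⟩
  choose P hP using this
  have key : ∀ j, j ≠ 0 → PathOn (H j) (Function.update P 0 R0 j) Set.univ (v j) (w j) := by
    intro j hj
    rw [Function.update_of_ne hj]
    exact hP j hj
  refine ⟨Function.update P 0 R0, by simp, fun j => ?_, key⟩
  by_cases hj : j = 0
  · subst hj
    simpa using h0
  · exact (key j hj).le

theorem exists_family (hP : ∀ j, j ≠ 0 → HasHamPath (H j) (v j) (w j)) {i : Fin (k + 1)}
    (hi : i ≠ 0) {R0 : SimpleGraph (V 0)} (h0 : R0 ≤ H 0) {Ri : SimpleGraph (V i)}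
    (h1 : Ri ≤ H i) :
    ∃ R : ∀ j, SimpleGraph (V j), R 0 = R0 ∧ R i = Ri ∧ (∀ j, R j ≤ H j) ∧
      ∀ j, j ≠ 0 → j ≠ i → PathOn (H j) (R j) Set.univ (v j) (w j) := by
  obtain ⟨P, hP0, hP1, hP2⟩ := exists_family_zero hP h0
  refine ⟨Function.update P i Ri, ?_, by simp, fun j => ?_, fun j hj hji => ?_⟩
  · rw [Function.update_of_ne hi.symm]
    exact hP0
  · by_cases hj : j = i
    · subst hj
      simpa using h1
    · rw [Function.update_of_ne hj]
      exact hP1 j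
  · rw [Function.update_of_ne hji]
    exact hP2 j hj

/-- Block 0 becomes traversable, so the ring closes to a hamiltonian cycle; only `x` and `y` can
change degree. -/
theorem cheap_zero_of_path (hk : 2 ≤ k) (hP : ∀ j, j ≠ 0 → HasHamPath (H j) (v j) (w j))
    (hS : ∀ z, dg S z + ind (z = ⟨0, x⟩) + ind (z = ⟨0, y⟩) = 2) {c : V 0} (hv : v 0 ≠ c)
    (hw : w 0 ≠ c) {R0 : SimpleGraph (V 0)} (hR0 : PathOn (H 0) R0 {c}ᶜ (v 0) (w 0)) :
    Cheap (cyclicJoin H v w) S ⟨0, c⟩ := by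
  obtain ⟨R, rfl, hle, hR⟩ := exists_family_zero hP hR0.le
  refine cheap_of_hamCycle (T := glue v w R Set.univ) (glue_le_cyclicJoin hle) ?_ ?_ hS
  · refine spans_glue_of_all_but_one hk (fun j => ?_) 0 (fun _ _ => trivial) fun j _ => ⟨?_, ?_⟩
    · by_cases hj : j = 0
      · subst hj
        exact spans_part_mk hR0.spans
      · exact spans_part_of_ne hj (hR j hj).spans
    · rintro h
      obtain rfl : j = 0 := congrArg Sigma.fst h
      exact sigma_ne_of_snd_ne hw h
    · rintro h
      have hj : j + 1 = 0 := congrArg Sigma.fst h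
      rw [Set.mem_singleton_iff, hj] at h
      exact sigma_ne_of_snd_ne hv h
  · rintro ⟨j, a⟩ hz
    rw [dg_glue hk, ind_and_of (Set.mem_univ _), ind_and_of (Set.mem_univ _)]
    by_cases hj : j = 0
    · subst hj
      have := hR0.dg_add a (by rintro rfl; exact hz rfl)
      omega
    · have := (hR j hj).dg_add a trivial
      omega

/-- The hamiltonian path starts at `b`, leaves block 0 through `w 0` and runs round the ring to the
exit of the last block, which is block `0 - 1`. -/
theorem cheap_zero_entry (hk : 2 ≤ k) (hne : ∀ j, v j ≠ w j)
    (hP : ∀ j, j ≠ 0 → HasHamPath (H j) (v j) (w j))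
    (hS : ∀ z, dg S z + ind (z = ⟨0, x⟩) + ind (z = ⟨0, y⟩) = 2) {b : V 0} (hb : b ≠ v 0)
    (hbxy : b = x ∨ b = y) {R0 : SimpleGraph (V 0)}
    (hR0 : PathOn (H 0) R0 {v 0}ᶜ (w 0) b) : Cheap (cyclicJoin H v w) S ⟨0, v 0⟩ := by
  obtain ⟨R, rfl, hle, hR⟩ := exists_family_zero hP hR0.le
  have hl := sub_one_ne_self hk 0
  refine cheap_of_profile_two (T := glue v w R {0 - 1}ᶜ) (l₁ := ⟨0, b⟩)
    (l₂ := ⟨0 - 1, w (0 - 1)⟩) (not_isHam_del_of_eq hk hne (Or.inl rfl))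
    (nontrivial_compl hk hne _) (glue_le_cyclicJoin hle) ?_ (sigma_ne_of_snd_ne hb)
    (sigma_ne_of_fst_ne hl _ _) (sigma_ne_of_fst_ne hl.symm _ _) ?_ hS
    (hbxy.imp (congrArg _) (congrArg _))
  · refine spans_glue_of_all_but_one hk (fun j => ?_) (0 - 1) (fun _ h => h)
      fun j hj => ⟨?_, ?_⟩
    · by_cases hj : j = 0
      · subst hj
        exact spans_part_mk hR0.spans
      · exact spans_part_of_ne hj (hR j hj).spans
    · intro h
      obtain rfl : j = 0 := congrArg Sigma.fst h
      exact sigma_ne_of_snd_ne (hne 0).symm h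
    · exact sigma_ne_of_fst_ne (fun h => hj (eq_sub_of_add_eq h)) _ _
  · rintro ⟨j, a⟩ hz
    rw [dg_glue hk]
    by_cases hj : j = 0
    · subst hj
      have hav : a ≠ v 0 := by rintro rfl; exact hz rfl
      have := hR0.dg_add a hav
      rw [ind_and_of (show (0 : Fin (k + 1)) ∈ ({0 - 1}ᶜ : Set (Fin (k + 1))) from hl.symm),
        ind_not (p := a = v 0 ∧ _) fun h => hav h.1, ind_sigma, ind_sigma_ne hl.symm]
      omega
    · have := (hR j hj).dg_add a trivial
      rw [ind_and_of (show j - 1 ∈ ({0 - 1}ᶜ : Set (Fin (k + 1))) from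
        fun h => hj (sub_left_injective h)), ind_sigma_ne hj]
      by_cases hjl : j = 0 - 1
      · subst hjl
        rw [ind_and_not (fun h => h rfl), ind_sigma]
        omega
      · rw [ind_and_of (show j ∈ ({0 - 1}ᶜ : Set (Fin (k + 1))) from hjl), ind_sigma_ne hjl]
        omega

theorem cheap_zero_exit (hk : 2 ≤ k) (hne : ∀ j, v j ≠ w j)
    (hP : ∀ j, j ≠ 0 → HasHamPath (H j) (v j) (w j))
    (hS : ∀ z, dg S z + ind (z = ⟨0, x⟩) + ind (z = ⟨0, y⟩) = 2) {b : V 0} (hb : b ≠ w 0)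
    (hbxy : b = x ∨ b = y) {R0 : SimpleGraph (V 0)}
    (hR0 : PathOn (H 0) R0 {w 0}ᶜ (v 0) b) : Cheap (cyclicJoin H v w) S ⟨0, w 0⟩ := by
  obtain ⟨R, rfl, hle, hR⟩ := exists_family_zero hP hR0.le
  have hl := sub_one_ne_self hk 0
  have h10 := one_ne_zero_fin hk
  refine cheap_of_profile_two (T := glue v w R {0}ᶜ) (l₁ := ⟨0, b⟩)
    (l₂ := ⟨1, v 1⟩) (not_isHam_del_of_eq hk hne (Or.inr rfl))
    (nontrivial_compl hk hne _) (glue_le_cyclicJoin hle) ?_ (sigma_ne_of_snd_ne hb)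
    (sigma_ne_of_fst_ne h10 _ _) (sigma_ne_of_fst_ne h10.symm _ _) ?_ hS
    (hbxy.imp (congrArg _) (congrArg _))
  · refine spans_glue_of_all_but_one hk (fun j => ?_) 0 (fun _ h => h)
      fun j hj => ⟨?_, ?_⟩
    · by_cases hj : j = 0
      · subst hj
        exact spans_part_mk hR0.spans
      · exact spans_part_of_ne hj (hR j hj).spans
    · exact sigma_ne_of_fst_ne hj _ _
    · intro h
      have hj : j + 1 = 0 := congrArg Sigma.fst h
      rw [Set.mem_singleton_iff, hj] at h
      exact sigma_ne_of_snd_ne (hne 0) h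
  · rintro ⟨j, a⟩ hz
    rw [dg_glue hk]
    by_cases hj : j = 0
    · subst hj
      have hav : a ≠ w 0 := by rintro rfl; exact hz rfl
      have := hR0.dg_add a hav
      rw [ind_and_of (show (0 : Fin (k + 1)) - 1 ∈ ({0}ᶜ : Set (Fin (k + 1))) from hl),
        ind_not (p := a = w 0 ∧ _) fun h => hav h.1, ind_sigma, ind_sigma_ne h10.symm]
      omega
    · have := (hR j hj).dg_add a trivial
      rw [ind_and_of (show j ∈ ({0}ᶜ : Set (Fin (k + 1))) from hj), ind_sigma_ne hj]
      by_cases hjl : j = 1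
      · subst hjl
        rw [ind_and_not (fun h => h (sub_self 1)), ind_sigma]
        omega
      · rw [ind_and_of (show j - 1 ∈ ({0}ᶜ : Set (Fin (k + 1))) from
          fun h => hjl (sub_eq_zero.1 h)), ind_sigma_ne hjl]
        omega

/-- The link between blocks 0 and 1 is dropped: the hamiltonian path goes from `z` out through `v
0`, backwards round the ring, and enters block 1 through `w 1` to end at `n`. It serves both `c = v
1` and inner vertices `c`. -/
theorem cheap_first (hk : 2 ≤ k) (hne : ∀ j, v j ≠ w j)
    (hH : ¬ HasHamPath (H 0) (v 0) (w 0)) (hP : ∀ j, j ≠ 0 → HasHamPath (H j) (v j) (w j))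
    (hS : ∀ z, dg S z + ind (z = ⟨0, x⟩) + ind (z = ⟨0, y⟩) = 2) {z : V 0}
    (hzxy : z = x ∨ z = y) {R0 : SimpleGraph (V 0)} (hR0 : PathOn (H 0) R0 Set.univ (v 0) z)
    {c n : V 1} (hwc : w 1 ≠ c) (hnc : n ≠ c) {R1 : SimpleGraph (V 1)}
    (hR1 : PathOn (H 1) R1 {c}ᶜ (w 1) n) : Cheap (cyclicJoin H v w) S ⟨1, c⟩ := by
  have h10 := one_ne_zero_fin hk
  have hl := sub_one_ne_self hk 0
  obtain ⟨R, rfl, rfl, hle, hR⟩ := exists_family hP h10 hR0.le hR1.le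
  refine cheap_of_profile_two (T := glue v w R {0}ᶜ) (l₁ := ⟨0, z⟩)
    (l₂ := ⟨1, n⟩) (not_isHam_del_of_ne_zero hk hne hH h10)
    (nontrivial_compl hk hne _) (glue_le_cyclicJoin hle) ?_ (sigma_ne_of_fst_ne h10.symm _ _)
    (sigma_ne_of_snd_ne hnc) (sigma_ne_of_fst_ne h10.symm _ _) ?_ hS
    (hzxy.imp (congrArg _) (congrArg _))
  · refine spans_glue_of_all_but_one hk (fun j => ?_) 0 (fun _ h => h)
      fun j hj => ⟨?_, ?_⟩
    · by_cases hj1 : j = 1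
      · subst hj1
        exact spans_part_mk hR1.spans
      refine spans_part_of_ne hj1 ?_
      by_cases hj : j = 0
      · subst hj
        exact hR0.spans
      · exact (hR j hj hj1).spans
    · intro h
      obtain rfl : j = 1 := congrArg Sigma.fst h
      exact sigma_ne_of_snd_ne hwc h
    · exact sigma_ne_of_fst_ne (fun h => hj (by simpa using h)) _ _
  · rintro ⟨j, a⟩ hz
    rw [dg_glue hk]
    by_cases hj : j = 0
    · subst hj
      have := hR0.dg_add a trivial
      rw [ind_and_of (show (0 : Fin (k + 1)) - 1 ∈ ({0}ᶜ : Set (Fin (k + 1))) from hl),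
        ind_and_not (fun h => h rfl), ind_sigma, ind_sigma_ne h10.symm]
      omega
    rw [ind_and_of (show j ∈ ({0}ᶜ : Set (Fin (k + 1))) from hj), ind_sigma_ne hj]
    by_cases hj1 : j = 1
    · subst hj1
      have := hR1.dg_add a (by rintro rfl; exact hz rfl)
      rw [ind_and_not (fun h => h (sub_self 1)), ind_sigma]
      omega
    · have := (hR j hj hj1).dg_add a trivial
      rw [ind_and_of (show j - 1 ∈ ({0}ᶜ : Set (Fin (k + 1))) from
        fun h => hj1 (sub_eq_zero.1 h)), ind_sigma_ne hj1]
      omega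

/-- Mirror image of `cheap_first`, for the last block `q`, which precedes block 0. -/
theorem cheap_last (hk : 2 ≤ k) (hne : ∀ j, v j ≠ w j)
    (hH : ¬ HasHamPath (H 0) (v 0) (w 0)) (hP : ∀ j, j ≠ 0 → HasHamPath (H j) (v j) (w j))
    (hS : ∀ z, dg S z + ind (z = ⟨0, x⟩) + ind (z = ⟨0, y⟩) = 2) {z : V 0}
    (hzxy : z = x ∨ z = y) {R0 : SimpleGraph (V 0)} (hR0 : PathOn (H 0) R0 Set.univ (w 0) z)
    {q : Fin (k + 1)} (hq : 0 - 1 = q) {c n : V q} (hvc : v q ≠ c) (hnc : n ≠ c)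
    {Rq : SimpleGraph (V q)} (hRq : PathOn (H q) Rq {c}ᶜ (v q) n) :
    Cheap (cyclicJoin H v w) S ⟨q, c⟩ := by
  have hq0 : q ≠ 0 := hq ▸ sub_one_ne_self hk 0
  obtain ⟨R, rfl, rfl, hle, hR⟩ := exists_family hP hq0 hR0.le hRq.le
  have hsub : ∀ {j : Fin (k + 1)}, j ≠ 0 → j - 1 ∈ ({q}ᶜ : Set (Fin (k + 1))) := by
    rintro j hj rfl
    exact hj (sub_left_injective hq).symm
  refine cheap_of_profile_two (T := glue v w R {q}ᶜ) (l₁ := ⟨0, z⟩)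
    (l₂ := ⟨q, n⟩) (not_isHam_del_of_ne_zero hk hne hH hq0)
    (nontrivial_compl hk hne _) (glue_le_cyclicJoin hle) ?_ (sigma_ne_of_fst_ne hq0.symm _ _)
    (sigma_ne_of_snd_ne hnc) (sigma_ne_of_fst_ne hq0.symm _ _) ?_ hS
    (hzxy.imp (congrArg _) (congrArg _))
  · refine spans_glue_of_all_but_one hk (fun j => ?_) q (fun _ h => h)
      fun j hj => ⟨?_, ?_⟩
    · by_cases hj1 : j = q
      · subst hj1
        exact spans_part_mk hRq.spans
      refine spans_part_of_ne hj1 ?_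
      by_cases hj : j = 0
      · subst hj
        exact hR0.spans
      · exact (hR j hj hj1).spans
    · exact sigma_ne_of_fst_ne hj _ _
    · intro h
      obtain rfl : j + 1 = q := congrArg Sigma.fst h
      exact sigma_ne_of_snd_ne hvc h
  · rintro ⟨j, a⟩ hz
    rw [dg_glue hk]
    by_cases hj : j = 0
    · subst hj
      have := hR0.dg_add a trivial
      rw [ind_and_of (show (0 : Fin (k + 1)) ∈ ({q}ᶜ : Set (Fin (k + 1))) from hq0.symm),
        ind_and_not (fun h => h hq), ind_sigma, ind_sigma_ne hq0.symm]
      omega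
    rw [ind_and_of (hsub hj), ind_sigma_ne hj]
    by_cases hj1 : j = q
    · subst hj1
      have := hRq.dg_add a (by rintro rfl; exact hz rfl)
      rw [ind_and_not (fun h => h rfl), ind_sigma]
      omega
    · have := (hR j hj hj1).dg_add a trivial
      rw [ind_and_of (show j ∈ ({q}ᶜ : Set (Fin (k + 1))) from hj1), ind_sigma_ne hj1]
      omega

end Upper

/-! ### Upper bound: deletions away from block 0 -/

section Upper

variable {k : ℕ} {V : Fin (k + 1) → Type*} {H : ∀ i, SimpleGraph (V i)} {v w : ∀ i, V i}

theorem spans_glue_univ_del (hk : 2 ≤ k) {R : ∀ j, SimpleGraph (V j)}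
    (h0 : ∀ a, (R 0).Reachable a (v 0) ∨ (R 0).Reachable a (w 0)) {i : Fin (k + 1)} (hi : i ≠ 0)
    {c : V i} (hv : v i ≠ c) (hw : w i ≠ c) (hRi : Spans (R i) {c}ᶜ)
    (hR : ∀ j, j ≠ 0 → j ≠ i → Spans (R j) Set.univ) :
    Spans (glue v w R Set.univ) {⟨i, c⟩}ᶜ := by
  refine spans_glue_of_two_parts hk (fun j hj => ?_) (fun a b _ => ?_) (fun a _ => h0 a)
    fun j => ⟨?_, ?_⟩
  · by_cases hj1 : j = i
    · subst hj1
      exact spans_part_mk hRi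
    · exact spans_part_of_ne hj1 (hR j hj hj1)
  · rw [part_compl_of_ne hi.symm]
    trivial
  · intro h
    obtain rfl : j = i := congrArg Sigma.fst h
    exact sigma_ne_of_snd_ne hw h
  · intro h
    obtain rfl : j + 1 = i := congrArg Sigma.fst h
    exact sigma_ne_of_snd_ne hv h

variable [∀ i, Fintype (V i)] {S : SimpleGraph (Σ i, V i)} {x y : V 0}

/-- `R` is a spanning tree of `H[D]` with the leaves `p`, `q`, `t` and the branch `b`. -/
structure TripodOn {W : Type*} (H R : SimpleGraph W) (D : Set W) (p q t b : W) : Prop where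
  le : R ≤ H
  spans : Spans R D
  dg_add : ∀ z ∈ D, dg R z + ind (z = p) + ind (z = q) + ind (z = t) = 2 + ind (z = b)

/-- The blocks 0, `m` and `m + 1` each contain a leaf. -/
theorem three_le_leafNumber_del (hk : 2 ≤ k) (hne : ∀ j, v j ≠ w j)
    (hH : ¬ HasHamPath (H 0) (v 0) (w 0)) {m : Fin (k + 1)} (hm : m ≠ 0) (hm1 : m + 1 ≠ 0)
    {u : Σ i, V i} (hu : u = ⟨m, w m⟩ ∨ u = ⟨m + 1, v (m + 1)⟩)
    {T' : SimpleGraph ({u}ᶜ : Set (Σ i, V i))}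
    (hT' : IsSpanningTree (del (cyclicJoin H v w) u) T') : 3 ≤ leafNumber T' := by
  obtain ⟨T, hT, hmem, rfl⟩ := exists_extension hT'.1
  obtain ⟨hD, hs⟩ := (isTree_induce_iff hmem).1 hT'.2
  obtain ⟨-, -, ⟨a, ha⟩, h3, h4⟩ := spanningTree_del_shape hk hne hH hm hm1 hu hT hD
    (isAcyclic_of_induce hmem hT'.2.2) hs
  obtain ⟨b, hb, hb'⟩ := exists_dg_lt_two (h3.trans_lt (by decide))
  obtain ⟨c, hc, hc'⟩ := exists_dg_lt_two (h4.trans_lt (by decide))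
  have hu0 : u.1 ≠ 0 := by rcases hu with rfl | rfl <;> assumption
  have ha0 : (⟨0, a⟩ : Σ i, V i) ∈ ({u}ᶜ : Set (Σ i, V i)) := by
    rintro rfl
    exact hu0 rfl
  have hleaf : ∀ z : ({u}ᶜ : Set (Σ i, V i)), dg T z < 2 →
      z ∈ leaves (T.induce ({u}ᶜ : Set (Σ i, V i))) := fun z hz => by
    rw [mem_leaves_iff, dg_induce hmem]
    have := dg_pos_of_spans_compl hk hne hD z z.2
    omega
  have h := Set.encard_eq_three.2 ⟨(⟨⟨0, a⟩, ha0⟩ : ({u}ᶜ : Set (Σ i, V i))), ⟨⟨m, b⟩, hb⟩,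
    ⟨⟨m + 1, c⟩, hc⟩, fun h => hm.symm (congrArg (fun z => z.1.1) h),
    fun h => hm1.symm (congrArg (fun z => z.1.1) h),
    fun h => (add_one_ne_self hk m).symm (congrArg (fun z => z.1.1) h), rfl⟩
  rw [leafNumber, ← h]
  refine Set.encard_le_encard ?_
  rintro z (rfl | rfl | rfl)
  · exact hleaf _ ha
  · exact hleaf _ hb'
  · exact hleaf _ hc'

/-- The ring is cut at link `m` and block 0 carries the tree from (vi). Its leaf `l` is an end of
`S`, so only the branch `b` and the leaves `w m` and `n` can change degree. -/
theorem cheap_entry (hk : 2 ≤ k) (hne : ∀ j, v j ≠ w j)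
    (hH : ¬ HasHamPath (H 0) (v 0) (w 0)) (hP : ∀ j, j ≠ 0 → HasHamPath (H j) (v j) (w j))
    (hS : ∀ z, dg S z + ind (z = ⟨0, x⟩) + ind (z = ⟨0, y⟩) = 2) {l b : V 0} (hlb : l ≠ b)
    (hxy : (l = x ∧ b = y) ∨ (l = y ∧ b = x)) {R0 : SimpleGraph (V 0)}
    (hR0 : TripodOn (H 0) R0 Set.univ (v 0) (w 0) l b) {m : Fin (k + 1)} (hm : m ≠ 0)
    (hm1 : m + 1 ≠ 0) {n : V (m + 1)} (hn : n ≠ v (m + 1)) {R1 : SimpleGraph (V (m + 1))}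
    (hR1 : PathOn (H (m + 1)) R1 {v (m + 1)}ᶜ (w (m + 1)) n) :
    Cheap (cyclicJoin H v w) S ⟨m + 1, v (m + 1)⟩ := by
  have hmm := add_one_ne_self hk m
  obtain ⟨R, rfl, rfl, hle, hR⟩ := exists_family hP hm1 hR0.le hR1.le
  have hd : ∀ z ≠ (⟨m + 1, v (m + 1)⟩ : Σ i, V i), dg (glue v w R {m}ᶜ) z + ind (z = ⟨0, l⟩) +
      ind (z = ⟨m, w m⟩) + ind (z = ⟨m + 1, n⟩) = 2 + ind (z = ⟨0, b⟩) := by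
    rintro ⟨j, a⟩ hz
    rw [dg_glue hk]
    by_cases hj : j = 0
    · subst hj
      have := hR0.dg_add a trivial
      rw [ind_and_of (show (0 : Fin (k + 1)) ∈ ({m}ᶜ : Set (Fin (k + 1))) from hm.symm),
        ind_and_of (show (0 : Fin (k + 1)) - 1 ∈ ({m}ᶜ : Set (Fin (k + 1))) from
          fun h => hm1 (eq_sub_iff_add_eq.1 (Eq.symm h))), ind_sigma, ind_sigma,
        ind_sigma_ne hm.symm, ind_sigma_ne hm1.symm]
      omega
    rw [ind_sigma_ne hj, ind_sigma_ne hj]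
    by_cases hj1 : j = m + 1
    · subst hj1
      have hav : a ≠ v (m + 1) := by rintro rfl; exact hz rfl
      have := hR1.dg_add a hav
      rw [ind_and_of (show m + 1 ∈ ({m}ᶜ : Set (Fin (k + 1))) from hmm),
        ind_not (p := a = v (m + 1) ∧ _) fun h => hav h.1, ind_sigma, ind_sigma_ne hmm]
      omega
    have := (hR j hj hj1).dg_add a trivial
    rw [ind_and_of (show j - 1 ∈ ({m}ᶜ : Set (Fin (k + 1))) from
      fun h => hj1 (sub_eq_iff_eq_add.1 h)), ind_sigma_ne hj1]
    by_cases hj2 : j = m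
    · subst hj2
      rw [ind_and_not (fun h => h rfl), ind_sigma]
      omega
    · rw [ind_and_of (show j ∈ ({m}ᶜ : Set (Fin (k + 1))) from hj2), ind_sigma_ne hj2]
      omega
  refine cheap_of_profile_three (T := glue v w R {m}ᶜ) (l₁ := ⟨0, l⟩) (l₂ := ⟨m, w m⟩)
    (l₃ := ⟨m + 1, n⟩) (b := ⟨0, b⟩) (z₁ := ⟨0, b⟩) (z₂ := ⟨m, w m⟩) (z₃ := ⟨m + 1, n⟩)
    (not_isHam_del_of_ne_zero hk hne hH hm1)
    (fun T' hT' => three_le_leafNumber_del hk hne hH hm hm1 (Or.inr rfl) hT')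
    (glue_le_cyclicJoin hle) ?_ (sigma_ne_of_fst_ne hm1.symm _ _)
    (sigma_ne_of_fst_ne hmm.symm _ _) (sigma_ne_of_snd_ne hn) (sigma_ne_of_fst_ne hm1.symm _ _)
    (sigma_ne_of_fst_ne hm.symm _ _) (sigma_ne_of_fst_ne hm1.symm _ _)
    (sigma_ne_of_fst_ne hmm.symm _ _) (sigma_ne_of_snd_ne hlb) (sigma_ne_of_fst_ne hm _ _)
    (sigma_ne_of_fst_ne hm1 _ _) hd ?_
  · refine spans_glue_of_all_but_one hk (fun j => ?_) m (fun _ h => h) fun j hj => ⟨?_, ?_⟩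
    · by_cases hj1 : j = m + 1
      · subst hj1
        exact spans_part_mk hR1.spans
      refine spans_part_of_ne hj1 ?_
      by_cases hj : j = 0
      · subst hj
        exact hR0.spans
      · exact (hR j hj hj1).spans
    · intro h
      obtain rfl : j = m + 1 := congrArg Sigma.fst h
      exact sigma_ne_of_snd_ne (hne _).symm h
    · exact sigma_ne_of_fst_ne (fun h => hj (add_right_cancel h)) _ _
  · intro z hz h1 h2 h3
    have e1 := hd z hz
    have e2 := hS z
    rw [ind_not h1, ind_not h2, ind_not h3] at e1
    rcases hxy with ⟨rfl, rfl⟩ | ⟨rfl, rfl⟩ <;> rw [ind_not h1] at e2 <;> omega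

/-- Mirror image of `cheap_entry`, at the other end of link `m`. -/
theorem cheap_exit (hk : 2 ≤ k) (hne : ∀ j, v j ≠ w j)
    (hH : ¬ HasHamPath (H 0) (v 0) (w 0)) (hP : ∀ j, j ≠ 0 → HasHamPath (H j) (v j) (w j))
    (hS : ∀ z, dg S z + ind (z = ⟨0, x⟩) + ind (z = ⟨0, y⟩) = 2) {l b : V 0} (hlb : l ≠ b)
    (hxy : (l = x ∧ b = y) ∨ (l = y ∧ b = x)) {R0 : SimpleGraph (V 0)}
    (hR0 : TripodOn (H 0) R0 Set.univ (v 0) (w 0) l b) {m : Fin (k + 1)} (hm : m ≠ 0)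
    (hm1 : m + 1 ≠ 0) {n : V m} (hn : n ≠ w m) {R1 : SimpleGraph (V m)}
    (hR1 : PathOn (H m) R1 {w m}ᶜ (v m) n) :
    Cheap (cyclicJoin H v w) S ⟨m, w m⟩ := by
  have hmm := add_one_ne_self hk m
  obtain ⟨R, rfl, rfl, hle, hR⟩ := exists_family hP hm hR0.le hR1.le
  have hd : ∀ z ≠ (⟨m, w m⟩ : Σ i, V i), dg (glue v w R {m}ᶜ) z + ind (z = ⟨0, l⟩) +
      ind (z = ⟨m, n⟩) + ind (z = ⟨m + 1, v (m + 1)⟩) = 2 + ind (z = ⟨0, b⟩) := by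
    rintro ⟨j, a⟩ hz
    rw [dg_glue hk]
    by_cases hj : j = 0
    · subst hj
      have := hR0.dg_add a trivial
      rw [ind_and_of (show (0 : Fin (k + 1)) ∈ ({m}ᶜ : Set (Fin (k + 1))) from hm.symm),
        ind_and_of (show (0 : Fin (k + 1)) - 1 ∈ ({m}ᶜ : Set (Fin (k + 1))) from
          fun h => hm1 (eq_sub_iff_add_eq.1 (Eq.symm h))), ind_sigma, ind_sigma,
        ind_sigma_ne hm.symm, ind_sigma_ne hm1.symm]
      omega
    rw [ind_sigma_ne hj, ind_sigma_ne hj]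
    by_cases hj1 : j = m
    · subst hj1
      have hav : a ≠ w j := by rintro rfl; exact hz rfl
      have := hR1.dg_add a hav
      rw [ind_and_of (show j - 1 ∈ ({j}ᶜ : Set (Fin (k + 1))) from sub_one_ne_self hk j),
        ind_not (p := a = w j ∧ _) fun h => hav h.1, ind_sigma, ind_sigma_ne hmm.symm]
      omega
    have := (hR j hj hj1).dg_add a trivial
    rw [ind_and_of (show j ∈ ({m}ᶜ : Set (Fin (k + 1))) from hj1), ind_sigma_ne hj1]
    by_cases hj2 : j = m + 1
    · subst hj2
      rw [ind_and_not (fun h => h (add_sub_cancel_right m 1)), ind_sigma]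
      omega
    · rw [ind_and_of (show j - 1 ∈ ({m}ᶜ : Set (Fin (k + 1))) from
        fun h => hj2 (sub_eq_iff_eq_add.1 h)), ind_sigma_ne hj2]
      omega
  refine cheap_of_profile_three (T := glue v w R {m}ᶜ) (l₁ := ⟨0, l⟩) (l₂ := ⟨m, n⟩)
    (l₃ := ⟨m + 1, v (m + 1)⟩) (b := ⟨0, b⟩) (z₁ := ⟨0, b⟩) (z₂ := ⟨m, n⟩)
    (z₃ := ⟨m + 1, v (m + 1)⟩) (not_isHam_del_of_ne_zero hk hne hH hm)
    (fun T' hT' => three_le_leafNumber_del hk hne hH hm hm1 (Or.inl rfl) hT')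
    (glue_le_cyclicJoin hle) ?_ (sigma_ne_of_fst_ne hm.symm _ _)
    (sigma_ne_of_snd_ne hn) (sigma_ne_of_fst_ne hmm _ _) (sigma_ne_of_fst_ne hm.symm _ _)
    (sigma_ne_of_fst_ne hm.symm _ _) (sigma_ne_of_fst_ne hm1.symm _ _)
    (sigma_ne_of_fst_ne hmm.symm _ _) (sigma_ne_of_snd_ne hlb) (sigma_ne_of_fst_ne hm _ _)
    (sigma_ne_of_fst_ne hm1 _ _) hd ?_
  · refine spans_glue_of_all_but_one hk (fun j => ?_) m (fun _ h => h) fun j hj => ⟨?_, ?_⟩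
    · by_cases hj1 : j = m
      · subst hj1
        exact spans_part_mk hR1.spans
      refine spans_part_of_ne hj1 ?_
      by_cases hj : j = 0
      · subst hj
        exact hR0.spans
      · exact (hR j hj hj1).spans
    · exact sigma_ne_of_fst_ne hj _ _
    · intro h
      obtain rfl : j + 1 = m := congrArg Sigma.fst h
      exact sigma_ne_of_snd_ne (hne _) h
  · intro z hz h1 h2 h3
    have e1 := hd z hz
    have e2 := hS z
    rw [ind_not h1, ind_not h2, ind_not h3] at e1
    rcases hxy with ⟨rfl, rfl⟩ | ⟨rfl, rfl⟩ <;> rw [ind_not h1] at e2 <;> omega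

/-- The block of `c` is still traversable, so rerouting inside it gives a hamiltonian path with the
ends of `S`, and no degree changes. -/
theorem cheap_of_path (hk : 2 ≤ k) (hne : ∀ j, v j ≠ w j)
    (hH : ¬ HasHamPath (H 0) (v 0) (w 0)) (hP : ∀ j, j ≠ 0 → HasHamPath (H j) (v j) (w j))
    (hS : ∀ z, dg S z + ind (z = ⟨0, x⟩) + ind (z = ⟨0, y⟩) = 2) (hxy : x ≠ y)
    {R0 : SimpleGraph (V 0)} (h0le : R0 ≤ H 0)
    (h0 : ∀ a, R0.Reachable a (v 0) ∨ R0.Reachable a (w 0))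
    (h0d : ∀ z, dg R0 z + ind (z = v 0) + ind (z = w 0) + ind (z = x) + ind (z = y) = 2)
    {i : Fin (k + 1)} (hi : i ≠ 0) {c : V i} (hv : v i ≠ c) (hw : w i ≠ c)
    {Ri : SimpleGraph (V i)} (hRi : PathOn (H i) Ri {c}ᶜ (v i) (w i)) :
    Cheap (cyclicJoin H v w) S ⟨i, c⟩ := by
  obtain ⟨R, rfl, rfl, hle, hR⟩ := exists_family hP hi h0le hRi.le
  refine cheap_of_profile_two (T := glue v w R Set.univ) (l₁ := ⟨0, x⟩) (l₂ := ⟨0, y⟩)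
    (not_isHam_del_of_ne_zero hk hne hH hi) (nontrivial_compl hk hne _) (glue_le_cyclicJoin hle)
    (spans_glue_univ_del hk h0 hi hv hw hRi.spans fun j hj hji => (hR j hj hji).spans)
    (sigma_ne_of_fst_ne hi.symm _ _) (sigma_ne_of_fst_ne hi.symm _ _) (sigma_ne_of_snd_ne hxy)
    ?_ hS (Or.inl rfl)
  rintro ⟨j, a⟩ hz
  rw [dg_glue hk, ind_and_of (Set.mem_univ _), ind_and_of (Set.mem_univ _)]
  by_cases hj : j = 0
  · subst hj
    have := h0d a
    rw [ind_sigma, ind_sigma]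
    omega
  rw [ind_sigma_ne hj, ind_sigma_ne hj]
  by_cases hj1 : j = i
  · subst hj1
    have := hRi.dg_add a (by rintro rfl; exact hz rfl)
    omega
  · have := (hR j hj hj1).dg_add a trivial
    omega

/-- Block `i` is crossed by a three-leaf tree instead of a path; only its extra leaf `t` and branch
`b` change degree. Three leaves are optimal because `hmin` excludes a hamiltonian path. -/
theorem cheap_of_tripod (hk : 2 ≤ k) (hne : ∀ j, v j ≠ w j)
    (hH : ¬ HasHamPath (H 0) (v 0) (w 0)) (hP : ∀ j, j ≠ 0 → HasHamPath (H j) (v j) (w j))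
    (hS : ∀ z, dg S z + ind (z = ⟨0, x⟩) + ind (z = ⟨0, y⟩) = 2) (hxy : x ≠ y)
    {R0 : SimpleGraph (V 0)} (h0le : R0 ≤ H 0)
    (h0 : ∀ a, R0.Reachable a (v 0) ∨ R0.Reachable a (w 0))
    (h0d : ∀ z, dg R0 z + ind (z = v 0) + ind (z = w 0) + ind (z = x) + ind (z = y) = 2)
    {i : Fin (k + 1)} (hi : i ≠ 0) {c : V i} (hv : v i ≠ c) (hw : w i ≠ c)
    {t b : V i} (ht : t ≠ c) (hb : b ≠ c) (htb : t ≠ b)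
    {Ri : SimpleGraph (V i)} (hRi : TripodOn (H i) Ri {c}ᶜ (v i) (w i) t b)
    (hmin : ∀ T', IsSpanningTree (del (cyclicJoin H v w) ⟨i, c⟩) T' → leafNumber T' ≠ 2) :
    Cheap (cyclicJoin H v w) S ⟨i, c⟩ := by
  obtain ⟨R, rfl, rfl, hle, hR⟩ := exists_family hP hi h0le hRi.le
  have hd : ∀ z ≠ (⟨i, c⟩ : Σ i, V i), dg (glue v w R Set.univ) z + ind (z = ⟨0, x⟩) +
      ind (z = ⟨0, y⟩) + ind (z = ⟨i, t⟩) = 2 + ind (z = ⟨i, b⟩) := by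
    rintro ⟨j, a⟩ hz
    rw [dg_glue hk, ind_and_of (Set.mem_univ _), ind_and_of (Set.mem_univ _)]
    by_cases hj : j = 0
    · subst hj
      have := h0d a
      rw [ind_sigma, ind_sigma, ind_sigma_ne hi.symm, ind_sigma_ne hi.symm]
      omega
    rw [ind_sigma_ne hj, ind_sigma_ne hj]
    by_cases hj1 : j = i
    · subst hj1
      have := hRi.dg_add a (by rintro rfl; exact hz rfl)
      rw [ind_sigma, ind_sigma]
      omega
    · have := (hR j hj hj1).dg_add a trivial
      rw [ind_sigma_ne hj1, ind_sigma_ne hj1]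
      omega
  have := nontrivial_compl hk hne ⟨i, c⟩
  refine cheap_of_profile_three (T := glue v w R Set.univ) (l₁ := ⟨0, x⟩) (l₂ := ⟨0, y⟩)
    (l₃ := ⟨i, t⟩) (b := ⟨i, b⟩) (z₁ := ⟨i, t⟩) (z₂ := ⟨i, b⟩) (z₃ := ⟨i, b⟩)
    (not_isHam_del_of_ne_zero hk hne hH hi) (fun T' hT' => ?_) (glue_le_cyclicJoin hle)
    (spans_glue_univ_del hk h0 hi hv hw hRi.spans fun j hj hji => (hR j hj hji).spans)
    (sigma_ne_of_fst_ne hi.symm _ _) (sigma_ne_of_fst_ne hi.symm _ _) (sigma_ne_of_snd_ne ht)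
    (sigma_ne_of_snd_ne hb) (sigma_ne_of_snd_ne hxy) (sigma_ne_of_fst_ne hi.symm _ _)
    (sigma_ne_of_fst_ne hi.symm _ _) (sigma_ne_of_fst_ne hi.symm _ _)
    (sigma_ne_of_fst_ne hi.symm _ _) (sigma_ne_of_snd_ne htb) hd fun z hz h1 h2 _ => ?_
  · have h2 := (two_le_leafNumber hT'.2).lt_of_ne (hmin T' hT').symm
    have h3 := Order.add_one_le_of_lt h2
    have h4 : (2 : ℕ∞) + 1 = 3 := by norm_num
    rwa [h4] at h3
  · have e1 := hd z hz
    have e2 := hS z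
    rw [ind_not h1, ind_not h2] at e1
    omega

end Upper

/-! ### Combining the cases -/

section Main

variable {k : ℕ} {V : Fin (k + 1) → Type*} {H : ∀ i, SimpleGraph (V i)} {v w : ∀ i, V i}
  [∀ i, Fintype (V i)] {S : SimpleGraph (Σ i, V i)}

/-- A traceable graph `G - u`, with `u` an inner vertex of a block `i ≠ 0` which is no longer
traversable, forces that block to be adjacent to block `0` and to have a hamiltonian path starting
at the vertex which faces away from block `0`. -/
theorem exists_pathOn_of_leafNumber_eq_two (hk : 2 ≤ k) (hne : ∀ j, v j ≠ w j)
    (hH : ¬ HasHamPath (H 0) (v 0) (w 0)) {i : Fin (k + 1)} (hi : i ≠ 0) {c : V i}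
    (hv : v i ≠ c) (hno : ¬ ∃ R, PathOn (H i) R {c}ᶜ (v i) (w i))
    {T' : SimpleGraph ({⟨i, c⟩}ᶜ : Set (Σ i, V i))}
    (hT' : IsSpanningTree (del (cyclicJoin H v w) ⟨i, c⟩) T') (h2 : leafNumber T' = 2) :
    (i = 1 ∧ ∃ n ≠ c, ∃ R, PathOn (H i) R {c}ᶜ (w i) n) ∨
      (0 - 1 = i ∧ ∃ n ≠ c, ∃ R, PathOn (H i) R {c}ᶜ (v i) n) := by
  obtain ⟨l₁, l₂, -, hprof⟩ := exists_profile_of_leafNumber_eq_two hT'.2 h2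
  obtain ⟨T, hT, hmem, rfl⟩ := exists_extension hT'.1
  have hac := isAcyclic_of_induce hmem hT'.2.2
  have hD := ((isTree_induce_iff hmem).1 hT'.2).1
  have hp0 : part ({⟨i, c⟩}ᶜ : Set (Σ i, V i)) 0 = Set.univ := part_compl_of_ne hi.symm
  have hpi : part ({⟨i, c⟩}ᶜ : Set (Σ i, V i)) i = {c}ᶜ := part_compl_mk c
  have h0mem : (⟨0, v 0⟩ : Σ i, V i) ∈ ({⟨i, c⟩}ᶜ : Set (Σ i, V i)) :=
    sigma_ne_of_fst_ne hi.symm _ _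
  have himem : (⟨i, v i⟩ : Σ i, V i) ∈ ({⟨i, c⟩}ᶜ : Set (Σ i, V i)) := sigma_ne_of_snd_ne hv
  obtain ⟨a, ha⟩ := exists_dg_ne_two hk hT hD himem hi hp0 hH
  obtain ⟨b, hb, hb'⟩ : ∃ b ∈ part ({⟨i, c⟩}ᶜ : Set (Σ i, V i)) i, dg T ⟨i, b⟩ ≠ 2 := by
    by_contra! hc
    obtain ⟨-, -, h3, h4⟩ :=
      traversed_block hk hT hD h0mem hi.symm (part_compl_nonempty hne _ i) hc
    rw [hpi] at h3 h4
    exact hno ⟨blk T i, blk_le hk hT i, h3, h4⟩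
  obtain ⟨a', b', hprof, hbi⟩ : ∃ (a' : V 0) (b' : V i), (∀ z ≠ (⟨i, c⟩ : Σ i, V i),
      dg T z + ind (z = ⟨0, a'⟩) + ind (z = ⟨i, b'⟩) = 2) ∧ b' ≠ c := by
    have hprof' : ∀ z ≠ (⟨i, c⟩ : Σ i, V i), dg T z + ind (z = l₁) + ind (z = l₂) = 2 := by
      intro z hz
      have := hprof ⟨z, hz⟩
      rwa [dg_induce hmem, Subtype.ext_iff, Subtype.ext_iff] at this
    have hor : ∀ z ≠ (⟨i, c⟩ : Σ i, V i), dg T z ≠ 2 → z = l₁ ∨ z = l₂ := by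
      intro z hz hz2
      by_contra! hc
      have := hprof' z hz
      rw [ind_not hc.1, ind_not hc.2] at this
      omega
    have hb0 : b ≠ c := by rwa [hpi] at hb
    -- Neither block 0 nor block `i` is 2-regular, so each contains exactly one of the two ends.
    rcases hor ⟨0, a⟩ (sigma_ne_of_fst_ne hi.symm _ _) ha with h | h <;>
      rcases hor ⟨i, b⟩ hb hb' with h' | h'
    · exact absurd (h'.trans h.symm) (sigma_ne_of_fst_ne hi _ _)
    · exact ⟨a, b, by rwa [h, h'], hb0⟩
    · refine ⟨a, b, fun z hz => ?_, hb0⟩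
      have := hprof' z hz
      rw [h, h']
      omega
    · exact absurd (h'.trans h.symm) (sigma_ne_of_fst_ne hi _ _)
  -- A missing link makes the excess sum of the block negative, so the block contains an end. Block
  -- 0 misses one link, and this locates `i` across it.
  have hend : ∀ j : Fin (k + 1), j ≠ 0 → (¬ Link v w T j ∨ ¬ Link v w T (j - 1)) → j = i := by
    intro j hj hmiss
    have h1 := sum_exc_block_le hk hT hmem hac j (part_compl_nonempty hne _ j)
    have h2 : ∑ a, exc T {⟨i, c⟩}ᶜ ⟨j, a⟩ < 0 := by
      have := ind_le_one (Link v w T j)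
      have := ind_le_one (Link v w T (j - 1))
      rcases hmiss with h | h <;> rw [ind_not h] at h1 <;> omega
    obtain ⟨e, he, he'⟩ := exists_dg_lt_two h2
    by_contra hji
    have := hprof ⟨j, e⟩ he
    rw [ind_sigma_ne hj, ind_sigma_ne hji] at this
    omega
  have hterm0 := terminal_block hk hT hD (j := 0) (t := a') himem hi (by rw [hp0]; trivial)
    fun z hz => by
      have := hprof ⟨0, z⟩ hz
      rw [ind_sigma_ne hi.symm, ind_sigma] at this
      omega
  have htermi := terminal_block hk hT hD (j := i) (t := b') h0mem hi.symm (by rwa [hpi])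
    fun z hz => by
      have := hprof ⟨i, z⟩ hz
      rw [ind_sigma_ne hi, ind_sigma] at this
      omega
  rw [hpi] at htermi
  rcases hterm0 with ⟨-, hl, -⟩ | ⟨-, hl, -⟩
  · have hqi := hend _ (sub_one_ne_self hk 0) (Or.inl hl)
    refine Or.inr ⟨hqi, b', hbi, ?_⟩
    rcases htermi with h | h
    · exact absurd h.1 (hqi ▸ hl)
    · exact ⟨blk T i, blk_le hk hT i, h.2.2.1, h.2.2.2⟩
  · have h1i := hend 1 (one_ne_zero_fin hk) (Or.inr (by rwa [sub_self]))
    refine Or.inl ⟨h1i.symm, b', hbi, ?_⟩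
    rcases htermi with h | h
    · exact ⟨blk T i, blk_le hk hT i, h.2.2.1, h.2.2.2⟩
    · refine absurd h.1 ?_
      rw [← h1i, sub_self]
      exact hl

/-- The spanning path of the cyclic join which combines two disjoint paths of block `0` with
traversals of all other blocks. -/
theorem exists_isSpanningTree_of_two_paths (hk : 2 ≤ k)
    (hP : ∀ j, j ≠ 0 → HasHamPath (H j) (v j) (w j)) {x y : V 0} {R0 : SimpleGraph (V 0)}
    (h0le : R0 ≤ H 0) (h0 : ∀ a, R0.Reachable a (v 0) ∨ R0.Reachable a (w 0))
    (h0d : ∀ z, dg R0 z + ind (z = v 0) + ind (z = w 0) + ind (z = x) + ind (z = y) = 2) :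
    ∃ S, IsSpanningTree (cyclicJoin H v w) S ∧
      ∀ z, dg S z + ind (z = ⟨0, x⟩) + ind (z = ⟨0, y⟩) = 2 := by
  obtain ⟨R, rfl, hle, hR⟩ := exists_family_zero hP h0le
  have hprof : ∀ z, dg (glue v w R Set.univ) z + ind (z = ⟨0, x⟩) + ind (z = ⟨0, y⟩) = 2 := by
    rintro ⟨j, a⟩
    rw [dg_glue hk, ind_and_of (Set.mem_univ _), ind_and_of (Set.mem_univ _)]
    by_cases hj : j = 0
    · subst hj
      have := h0d a
      rw [ind_sigma, ind_sigma]
      omega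
    · have := (hR j hj).dg_add a trivial
      rw [ind_sigma_ne hj, ind_sigma_ne hj]
      omega
  refine ⟨_, ⟨glue_le_cyclicJoin hle, isTree_iff_sum.2 ⟨spans_univ_iff.1 ?_, ?_⟩⟩, hprof⟩
  · exact spans_glue_of_two_parts hk (fun j hj => (hR j hj).spans) (fun _ _ _ => trivial)
      (fun a _ => h0 a) fun j => ⟨trivial, trivial⟩
  · have : ∀ z : Σ i, V i, dg (glue v w R Set.univ) z - 2 =
        - ind (z = ⟨0, x⟩) - ind (z = ⟨0, y⟩) := fun z => by
      have := hprof z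
      omega
    simp_rw [this]
    rw [Finset.sum_sub_distrib, Finset.sum_neg_distrib, sum_ind_eq, sum_ind_eq]
    rfl

/-- Case distinction on the position of `u`. The delicate case is an inner vertex of a block `i ≠ 0`
which is no longer traversable: the three-leaf tree is optimal only if `G - u` is not traceable. If
it is traceable, `exists_pathOn_of_leafNumber_eq_two` supplies the piece needed for a path with an
end in `{x, y}`. -/
theorem cheap_all (hk : 2 ≤ k) (hne : ∀ j, v j ≠ w j) {x y : V 0}
    (h1 : IsType1With (H 0) (v 0) (w 0) x y) (h2 : ∀ i, i ≠ 0 → IsType2 (H i) (v i) (w i))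
    (hS : ∀ z, dg S z + ind (z = ⟨0, x⟩) + ind (z = ⟨0, y⟩) = 2)
    {R0 : SimpleGraph (V 0)} (h0le : R0 ≤ H 0)
    (h0 : ∀ a, R0.Reachable a (v 0) ∨ R0.Reachable a (w 0))
    (h0d : ∀ z, dg R0 z + ind (z = v 0) + ind (z = w 0) + ind (z = x) + ind (z = y) = 2)
    (u : Σ i, V i) : Cheap (cyclicJoin H v w) S u := by
  have hP : ∀ j, j ≠ 0 → HasHamPath (H j) (v j) (w j) := fun j hj => (h2 j hj).ham
  have hH := h1.no_ham
  obtain ⟨hvw, hvx, hvy, hwx, hwy, hxy⟩ :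
      v 0 ≠ w 0 ∧ v 0 ≠ x ∧ v 0 ≠ y ∧ w 0 ≠ x ∧ w 0 ≠ y ∧ x ≠ y := by
    have := h1.pairwise_ne
    simp at this
    tauto
  obtain ⟨z, hz, hz'⟩ := h1.ham_v
  obtain ⟨Rv, hRv⟩ := exists_pathOn_univ hz'
  obtain ⟨z', hz2, hz2'⟩ := h1.ham_w
  obtain ⟨Rw, hRw⟩ := exists_pathOn_univ hz2'
  obtain ⟨l, b, Rt, hlb, hlbxy, hRt⟩ : ∃ l b Rt, l ≠ b ∧ ((l = x ∧ b = y) ∨ (l = y ∧ b = x)) ∧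
      TripodOn (H 0) Rt Set.univ (v 0) (w 0) l b := by
    obtain ⟨T, hT, hv, hw, hl, hb⟩ := h1.tree
    obtain ⟨l, b, hlT, hbT, h1l, h2l, -, -, hlb, hd⟩ :=
      exists_profile_of_leafNumber_eq_three hT.1.2 hT.2 hv hw hvw
    refine ⟨l, b, T, hlb, ?_, hT.1.1, spans_univ_iff.2 hT.1.2.1, fun z _ => hd z⟩
    rcases hl l hlT h1l.symm h2l.symm with rfl | rfl <;> rcases hb b hbT with rfl | rfl
    · exact absurd rfl hlb
    · exact Or.inl ⟨rfl, rfl⟩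
    · exact Or.inr ⟨rfl, rfl⟩
    · exact absurd rfl hlb
  obtain ⟨i, c⟩ := u
  by_cases hi : i = 0
  · subst hi
    by_cases hcv : v 0 = c
    · subst hcv
      obtain ⟨⟨a, ha⟩, ⟨b, hb⟩, hab, hbxy, hham⟩ := h1.ham_del_v
      obtain rfl : a = w 0 := hab.resolve_left ha
      obtain ⟨R, hR⟩ := exists_pathOn_compl hham
      exact cheap_zero_entry hk hne hP hS hb hbxy hR
    by_cases hcw : w 0 = c
    · subst hcw
      obtain ⟨⟨a, ha⟩, ⟨b, hb⟩, hab, hbxy, hham⟩ := h1.ham_del_w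
      obtain rfl : a = v 0 := hab.resolve_right ha
      obtain ⟨R, hR⟩ := exists_pathOn_compl hham
      exact cheap_zero_exit hk hne hP hS hb hbxy hR
    obtain ⟨R, hR⟩ := exists_pathOn_compl (h1.ham_del c hcv hcw)
    exact cheap_zero_of_path hk hP hS hcv hcw hR
  by_cases hcv : v i = c
  · subst hcv
    obtain ⟨n, hn, R, hRle, hRs, hRd⟩ := exists_path_del_endpoint (hne i) (hP i hi)
    have hR : PathOn (H i) R {v i}ᶜ (w i) n := ⟨hRle, hRs, hRd⟩
    by_cases hi1 : i = 1
    · subst hi1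
      exact cheap_first hk hne hH hP hS hz hRv (hne 1).symm hn hR
    · obtain ⟨m, rfl⟩ : ∃ m, i = m + 1 := ⟨i - 1, (sub_add_cancel i 1).symm⟩
      exact cheap_entry hk hne hH hP hS hlb hlbxy hRt (by simpa using hi1) hi hn hR
  by_cases hcw : w i = c
  · subst hcw
    have hPi : HasHamPath (H i) (w i) (v i) := by
      obtain ⟨T, hT1, hT2, hT3⟩ := hasHamPath_iff.1 (hP i hi)
      exact hasHamPath_iff.2 ⟨T, hT1, hT2, fun z => by have := hT3 z; omega⟩
    obtain ⟨n, hn, R, hRle, hRs, hRd⟩ := exists_path_del_endpoint (hne i).symm hPi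
    have hR : PathOn (H i) R {w i}ᶜ (v i) n := ⟨hRle, hRs, hRd⟩
    by_cases hi1 : i + 1 = 0
    · exact cheap_last hk hne hH hP hS hz2 hRw (sub_eq_of_eq_add hi1.symm) (hne i) hn hR
    · exact cheap_exit hk hne hH hP hS hlb hlbxy hRt hi hi1 hn hR
  by_cases hpath : ∃ R, PathOn (H i) R {c}ᶜ (v i) (w i)
  · obtain ⟨R, hR⟩ := hpath
    exact cheap_of_path hk hne hH hP hS hxy h0le h0 h0d hi hcv hcw hR
  by_cases htwo : ∃ T', IsSpanningTree (del (cyclicJoin H v w) ⟨i, c⟩) T' ∧ leafNumber T' = 2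
  · obtain ⟨T', hT', hT2⟩ := htwo
    rcases exists_pathOn_of_leafNumber_eq_two hk hne hH hi hcv hpath hT' hT2 with
      ⟨rfl, n, hn, R, hR⟩ | ⟨hq, n, hn, R, hR⟩
    · exact cheap_first hk hne hH hP hS hz hRv hcw hn hR
    · exact cheap_last hk hne hH hP hS hz2 hRw hq hcv hn hR
  rcases (h2 i hi).ham_del_or_tree c hcv hcw with hham | ⟨T', hT', hv', hw'⟩
  · exact absurd (exists_pathOn_compl hham) hpath
  obtain ⟨⟨t, ht⟩, ⟨b', hb'⟩, -, -, -, -, -, -, htb, hd⟩ :=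
    exists_profile_of_leafNumber_eq_three hT'.1.2 hT'.2 hv' hw'
      (fun h => hne i (congrArg Subtype.val h))
  obtain ⟨R, hRle, hm, rfl⟩ := exists_extension hT'.1.1
  refine cheap_of_tripod hk hne hH hP hS hxy h0le h0 h0d hi hcv hcw ht hb'
    (fun h => htb (Subtype.ext h)) ⟨hRle, (spans_iff_induce hm).2 hT'.1.2.1, fun z hz => ?_⟩
    fun T'' hT'' h => htwo ⟨T'', hT'', h⟩
  have := hd ⟨z, hz⟩
  rwa [dg_induce hm, Subtype.ext_iff, Subtype.ext_iff, Subtype.ext_iff, Subtype.ext_iff] at this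

/-- Block 0 is not 2-regular in `S`, so one end of the hamiltonian path `S` lies there, and
`exists_costly` applies after naming the ends suitably. -/
theorem three_le_faultCostOf (hk : 2 ≤ k) (hne : ∀ j, v j ≠ w j)
    (hH : ¬ HasHamPath (H 0) (v 0) (w 0))
    (hk' : 3 ≤ k ∨ (k = 2 ∧ ∀ i, i ≠ 0 → ∀ y : V i,
      ¬ (HasHamPath (H i) (v i) y ∧ HasHamPath (H i) (w i) y)))
    (hS : IsSpanningTree (cyclicJoin H v w) S) (hS2 : leafNumber S = 2) :
    3 ≤ faultCostOf (cyclicJoin H v w) S := by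
  obtain ⟨l₁, l₂, -, hprof⟩ := exists_profile_of_leafNumber_eq_two hS.2 hS2
  obtain ⟨u, hu0, hu⟩ : ∃ u, u.1 ≠ 0 ∧ Costly (cyclicJoin H v w) S u := by
    obtain ⟨a, ha⟩ := exists_dg_ne_two hk hS.1 (spans_univ_iff.2 hS.2.1) (j := 0)
      (y := ⟨1, v 1⟩) trivial (one_ne_zero_fin hk) Set.preimage_univ hH
    have hor : (⟨0, a⟩ : Σ i, V i) = l₁ ∨ (⟨0, a⟩ : Σ i, V i) = l₂ := by
      by_contra! hc
      have := hprof ⟨0, a⟩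
      rw [ind_not hc.1, ind_not hc.2] at this
      omega
    rcases hor with rfl | rfl
    · exact exists_costly hk hne hH hk' hS.1 hS.2 hprof rfl
    · exact exists_costly hk hne hH hk' hS.1 hS.2 (l := ⟨0, a⟩) (t := l₁)
        (fun z => by have := hprof z; omega) rfl
  refine le_iSup_of_le u (le_iInf₂ fun Su hSu => ?_)
  have hSu' := (isSpanningTree_of_mem_mlSubgraphs (not_isHam_del_of_ne_zero hk hne hH hu0) hSu).1
  obtain ⟨T, hT, hmem, rfl⟩ := exists_extension hSu'.1
  obtain ⟨hD, hs⟩ := (isTree_induce_iff hmem).1 hSu'.2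
  obtain ⟨z₁, z₂, z₃, h1, h2, h3, h12, h13, h23, d1, d2, d3⟩ :=
    hu T hT hD (isAcyclic_of_induce hmem hSu'.2.2) hs
  have h := Set.encard_eq_three.2 ⟨(⟨z₁, h1⟩ : ({u}ᶜ : Set (Σ i, V i))), ⟨z₂, h2⟩, ⟨z₃, h3⟩,
    fun h => h12 (congrArg Subtype.val h), fun h => h13 (congrArg Subtype.val h),
    fun h => h23 (congrArg Subtype.val h), rfl⟩
  rw [transitionCost, ← h]
  refine Set.encard_le_encard ?_
  rintro z (rfl | rfl | rfl) <;>
    rw [Set.mem_ofPred_eq, Ne, deg_eq_deg_iff, dg_induce hmem] <;> assumption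

theorem connected_of_mem_mlSubgraphs {X : Type*} [Finite X] {G S : SimpleGraph X}
    (hS : S ∈ mlSubgraphs G) : G.Connected := by
  rcases hS.1 with h | h
  · exact h.2.1.mono h.1
  · obtain ⟨h1, h2, -⟩ := isHamCycle_iff.1 h
    exact h2.mono h1

end Main

end FaultCost

open FaultCost

theorem mainTheorem4 (k : ℕ) (V : Fin (k + 1) → Type*) [∀ i, Fintype (V i)]
    (H : ∀ i, SimpleGraph (V i)) (v w : ∀ i, V i)
    (h1 : FaultCost.IsType1 (H 0) (v 0) (w 0))
    (h2 : ∀ i, i ≠ 0 → FaultCost.IsType2 (H i) (v i) (w i))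
    (hk : 3 ≤ k ∨ (k = 2 ∧ ∀ i, i ≠ 0 → ∀ y : V i,
      ¬ (FaultCost.HasHamPath (H i) (v i) y ∧ FaultCost.HasHamPath (H i) (w i) y))) :
    FaultCost.IsTwoConnected (FaultCost.cyclicJoin H v w) ∧
    Fintype.card (Σ i, V i) = ∑ i, Fintype.card (V i) ∧
    FaultCost.faultCost (FaultCost.cyclicJoin H v w) = 3 := by
  have hk2 : 2 ≤ k := by omega
  obtain ⟨x, y, h1⟩ := h1
  have hnd := h1.pairwise_ne
  simp only [List.nodup_cons, List.mem_cons, List.not_mem_nil, or_false, not_or] at hnd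
  obtain ⟨⟨hvw, hvx, -⟩, ⟨hwx, -⟩, hxy, -⟩ := hnd
  have hne : ∀ j, v j ≠ w j := fun j => by
    by_cases hj : j = 0
    · subst hj
      exact hvw
    · exact (h2 j hj).ne
  obtain ⟨P, Q, hP, hQ, hPQ⟩ := h1.two_paths
  obtain ⟨R0, h0le, h0, h0d⟩ := exists_two_paths hP hQ hPQ
  obtain ⟨S, hS, hprof⟩ :=
    exists_isSpanningTree_of_two_paths hk2 (fun j hj => (h2 j hj).ham) h0le h0 h0d
  have hS2 : leafNumber S = 2 := leafNumber_of_profile_two (sigma_ne_of_snd_ne hxy) hprof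
  have hcheap := cheap_all hk2 hne h1 h2 hprof h0le h0 h0d
  have hG : ¬ IsHam (cyclicJoin H v w) := not_isHam_cyclicJoin hk2 h1.no_ham
  have hnt : Nontrivial (Σ i, V i) := ⟨⟨0, v 0⟩, ⟨0, w 0⟩, sigma_ne_of_snd_ne hvw⟩
  have hSml : S ∈ mlSubgraphs (cyclicJoin H v w) :=
    mem_mlSubgraphs_of_minimal hG hS fun T' hT' => hS2 ▸ two_le_leafNumber hT'.2
  refine ⟨⟨?_, hS.2.1.mono hS.1, fun u => ?_⟩, Fintype.card_sigma, le_antisymm ?_ ?_⟩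
  · have h := Set.encard_eq_three.2 ⟨(⟨0, v 0⟩ : Σ i, V i), ⟨0, w 0⟩, ⟨0, x⟩,
      sigma_ne_of_snd_ne hvw, sigma_ne_of_snd_ne hvx, sigma_ne_of_snd_ne hwx, rfl⟩
    exact lt_of_lt_of_le (by norm_num) (h.ge.trans (Set.encard_le_encard (Set.subset_univ _)))
  -- An ml-subgraph of `G - u` is connected and spanning, so the upper bound also yields
  -- 2-connectedness.
  · obtain ⟨Su, hSu, -⟩ := hcheap u
    exact connected_of_mem_mlSubgraphs hSu
  · refine iInf₂_le_of_le S hSml (iSup_le fun u => ?_)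
    obtain ⟨Su, hSu, hcost⟩ := hcheap u
    exact iInf₂_le_of_le Su hSu hcost
  · refine le_iInf₂ fun S' hS' => ?_
    obtain ⟨hS't, hmin⟩ := isSpanningTree_of_mem_mlSubgraphs hG hS'
    exact three_le_faultCostOf hk2 hne h1.no_ham hk hS't
      (le_antisymm ((hmin S hS).trans hS2.le) (two_le_leafNumber hS't.2))
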